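/- **Model.** Let $N\ge 1$, $N_t,N_r\ge1$ with $N_tN_r\ge 2$, $d\ge 1$, $B\ge 0$ be integers and let $P,\zeta,\sigma,\tau,R,\theta>0$ be real numbers with $N\theta<1$. Put $Q=N_tN_r-1$, $\alpha=P\zeta/d$, $\breve a=\frac{(Q+1)d-1}{Q}$, $\breve b=(Q-1)\breve a$. There are $N$ transmitter-receiver pairs with $d$ streams each, and time is slotted. In each slot a set $S\subseteq\{1,\dots,N\}$ of active pairs is selected. The SINR of stream $m$ of an active user $k\in S$ is $$\gamma_k^{(m)}=\frac{\alpha\,G_k^{(m)}}{\sigma^2+\sum_{i\in S,\,i\ne k}\alpha\,\|h_{ki}\|^2 e_{ki}\,Z_{ki}^{(m)}} .$$ Here (for given $S$, $k\in S$ and $m$) the variables $G_k^{(m)}$ and $\|h_{ki}\|^2,\ e_{ki},\ Z_{ki}^{(m)}$ ($i\in S\setminus\{k\}$) are independent; $G_k^{(m)}$ (gain of the desired signal) is exponential with parameter $1$; $h_{ki}$ is a vector of $N_tN_r$ i.i.d. standard complex Gaussian entries; the quantization error $e_{ki}$ of the limited backhaul has distribution function $2^B\varepsilon^Q$ on $[0,2^{-B/Q}]$;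 and $Z_{ki}^{(m)}$ (residual interference factor) is distributed as $d$ times a $\mathrm{Beta}(\breve a,\breve b)$ variable, where $\mathrm{Beta}(\breve a,0)$ (case $Q=1$) means the unit mass at $1$. $G_k^{(m)}$ and $Z_{ki}^{(m)}$ may depend on $S$; the joint law is otherwise arbitrary. The fading is i.i.d. over slots. In a slot $t$ with active set $S$, user $k$ is served $B_k(t)=(1-|S|\theta)\sum_{m=1}^d R\,\mathbf 1\{\gamma_k^{(m)}\ge\tau\}$ bits if $k\in S$, and $B_k(t)=0$ otherwise. The arrivals $A(t)=(A_1(t),\dots,A_N(t))$ are i.i.d. in time, independent across users, nonnegative, bounded, and independent of the fading and of the scheduler's randomization; their mean vector is $\mathbf a=(a_1,\dots,a_N)$. The queues evolve by $q_k(t+1)=\max\{q_k(t)-B_k(t),0\}+A_k(t)$ from a deterministic $q(0)\in\mathbb R_+^N$. A centralized policy chooses the active set of slot $t$ as a measurable function of $q(t)$ and of a fresh random variable, uniform on $[0,1]$ and independent of everything else. The system is strongly stable if $\limsup_{T\to\infty}\frac1T\sum_{t=0}^{T-1}\mathbb E\,q_k(t)<\infty$ for all $k$. The stability region $\Lambda$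 is the set of $\mathbf a\in\mathbb R_+^N$ for which some centralized policy makes the system strongly stable for all arrival laws with mean $\mathbf a$ and all $q(0)\in\mathbb R_+^N$. **Rates.** Let $$r(L)=(1-L\theta)\,d\,R\,e^{-\sigma^2\tau/\alpha}F^{L-1},\qquad F=\Big(\frac{d\tau}{2^{B/Q}}+1\Big)^{-Q}{}_2F_1\Big(\breve b,Q;\breve a+\breve b;\frac{1}{\frac{2^{B/Q}}{d\tau}+1}\Big),$$ $I_L=\{r(L)\,\mathbf s:\mathbf s\in\{0,1\}^N,\ \|\mathbf s\|_1=L\}$ for integers $L\ge0$ (so $I_0=\{0\}$, and $I_L=\emptyset$ for $L>N$), and let $L_{\mathrm I}$ be an integer that maximizes the total average rate $L\,r(L)$ over the integers $L\ge0$. Let $\Lambda_{\mathrm I}=\mathcal{CH}\{I_0,I_1,\dots,I_{L_{\mathrm I}}\}$ be the (closed) convex hull of $I_0\cup I_1\cup\dots\cup I_{L_{\mathrm I}}$. **Theorem.** The stability region of the symmetric system with limited backhaul is $\Lambda_{\mathrm I}$, up to boundary points: 1. $\overline{\Lambda}=\Lambda_{\mathrm I}$; in particular $\Lambda\subseteq\Lambda_{\mathrm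 I}$. 2. Every point of the interior of $\Lambda_{\mathrm I}$ relative to $\mathbb R_+^N$ belongs to $\Lambda$. 3. If, for some arrival law with mean $\mathbf a$ and some $q(0)\in\mathbb R_+^N$, the system is strongly stable under some causal policy, that is, one whose active set in slot $t$ is a measurable function of everything that happened in the slots before $t$ and of a fresh randomization, then $\mathbf a\in\Lambda_{\mathrm I}$. -/

import Mathlib

open MeasureTheory ProbabilityTheory Topology Filter
open scoped ENNReal

noncomputable section

namespace SymIA

/-! ### Parameters and average rates -/

/-- Parameters of the symmetric `N`-pair MIMO interference network with limited backhaul. -/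
structure Params where
  /-- maximum number of transmitter-receiver pairs -/
  N : ℕ
  /-- antennas at each transmitter -/
  Nt : ℕ
  /-- antennas at each receiver -/
  Nr : ℕ
  /-- data streams per pair -/
  d : ℕ
  /-- quantization bits per channel matrix -/
  B : ℕ
  /-- total power at each transmitter -/
  P : ℝ
  /-- common path loss coefficient -/
  ζ : ℝ
  /-- noise standard deviation -/
  sigma : ℝ
  /-- SINR threshold -/
  τ : ℝ
  /-- bits per slot assigned to a stream whose SINR is at least the threshold -/
  R : ℝ
  /-- fraction of the slot needed to acquire the CSI of one user -/
  θ : ℝ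
  N_pos : 0 < N
  antennas : 2 ≤ Nt * Nr
  d_pos : 0 < d
  P_pos : 0 < P
  ζ_pos : 0 < ζ
  sigma_pos : 0 < sigma
  τ_pos : 0 < τ
  R_pos : 0 < R
  θ_pos : 0 < θ
  Nθ_lt_one : (N : ℝ) * θ < 1

namespace Params

variable (p : Params)

/-- `Q = N_t N_r - 1`, which is at least `1`. -/
def Q : ℕ := p.Nt * p.Nr - 1

/-- `α = P ζ / d`. -/
def α : ℝ := p.P * p.ζ / p.d

/-- The parameter `ă = (Q+1) d / Q - 1 / Q`. -/
def betaA : ℝ := ((p.Q : ℝ) + 1) * p.d / p.Q - 1 / p.Q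

/-- The parameter `b̆ = (Q-1) ă`. -/
def betaB : ℝ := ((p.Q : ℝ) - 1) * p.betaA

/-- `2 ^ (B / Q)`. -/
def δ : ℝ := (2 : ℝ) ^ ((p.B : ℝ) / (p.Q : ℝ))

/-- `F = (dτ / 2^(B/Q) + 1)^(-Q) ₂F₁(b̆, Q; ă + b̆; 1 / (2^(B/Q) / (dτ) + 1))`. -/
def F : ℝ :=
  (p.d * p.τ / p.δ + 1) ^ (-(p.Q : ℤ)) *
    ordinaryHypergeometric p.betaB (p.Q : ℝ) (p.betaA + p.betaB)
      (1 / (p.δ / (p.d * p.τ) + 1))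

/-- The average transmission rate `r(L) = (1 - Lθ) d R exp(-σ²τ/α) F^(L-1)` of an active user when
`L` pairs are active. -/
def r (L : ℕ) : ℝ :=
  (1 - L * p.θ) * p.d * p.R * Real.exp (-(p.sigma ^ 2 * p.τ / p.α)) * p.F ^ ((L : ℤ) - 1)

/-- The total average transmission rate `L r(L)`. -/
def rT (L : ℕ) : ℝ := L * p.r L

/-- `I_L = { r(L) s : s ∈ {0,1}^N, ‖s‖₁ = L }`; the vector `s` is the indicator of a set of `L`
pairs. -/
def ratePoints (L : ℕ) : Set (Fin p.N → ℝ) :=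
  {x | ∃ S : Finset (Fin p.N), S.card = L ∧ x = fun k => if k ∈ S then p.r L else 0}

/-- The convex hull of `I_0 = {0}, I_1, …, I_M`. It is the hull of a finite set, hence closed. -/
def rateHull (M : ℕ) : Set (Fin p.N → ℝ) :=
  convexHull ℝ (⋃ L ∈ Finset.range (M + 1), p.ratePoints L)

/-! ### Fading laws -/

/-- The standard circularly symmetric complex Gaussian law (zero mean, unit variance). -/
def complexGaussian : Measure ℂ :=
  ((gaussianReal 0 (1 / 2)).prod (gaussianReal 0 (1 / 2))).map (fun z => (⟨z.1, z.2⟩ : ℂ))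

/-- The law of `‖h‖²`, where `h` is the vectorization of an `N_r × N_t` matrix with i.i.d. standard
complex Gaussian entries. -/
def normSqLaw : Measure ℝ :=
  (Measure.pi (fun _ : Fin p.Nr × Fin p.Nt => complexGaussian)).map
    (fun h => ∑ i, ‖h i‖ ^ 2)

/-- The law of the quantization error: its distribution function is `2^B ε^Q` for
`0 ≤ ε ≤ 2^(-B/Q)`, that is, it has density `2^B Q ε^(Q-1)` on this interval. -/
def quantErrLaw : Measure ℝ :=
  (volume.restrict (Set.Icc 0 (p.δ)⁻¹)).withDensity
    (fun ε => ENNReal.ofReal (2 ^ p.B * p.Q * ε ^ (p.Q - 1)))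

/-- The law of the residual leakage factor `∑_j |w^H T^(j)|²` of an interferer: `d` times a
`Beta(ă, b̆)` variable, where `Beta(ă, 0)`, which occurs only for `Q = 1`, is the unit mass
at `1`. -/
def leakLaw : Measure ℝ :=
  (if p.Q = 1 then Measure.dirac 1 else betaMeasure p.betaA p.betaB).map (fun y => p.d * y)

end Params

/-- A model of the fading in one slot: random variables on a probability space `(H, law)`. The
variables `gain` and `leak` may depend on the set `S` of active pairs, since the combiners and
precoders do. The joint law is left free except for what one SINR involves. -/
structure Fading (p : Params) (H : Type*) [MeasurableSpace H] where
  law : Measure H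
  isProb : IsProbabilityMeasure law
  /-- `gain S k m` is `|u^H H_kk v|²` for stream `m` of user `k` -/
  gain : Finset (Fin p.N) → Fin p.N → Fin p.d → H → ℝ
  /-- `normSq k i` is `‖h_ki‖²` -/
  normSq : Fin p.N → Fin p.N → H → ℝ
  /-- `err k i` is the quantization error `e_ki` -/
  err : Fin p.N → Fin p.N → H → ℝ
  /-- `leak S k i m` is `∑_j |w_ki^H T_ki^(m,j)|²` -/
  leak : Finset (Fin p.N) → Fin p.N → Fin p.N → Fin p.d → H → ℝ
  measurable_gain : ∀ S k m, Measurable (gain S k m)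
  measurable_normSq : ∀ k i, Measurable (normSq k i)
  measurable_err : ∀ k i, Measurable (err k i)
  measurable_leak : ∀ S k i m, Measurable (leak S k i m)
  /-- For each stream of an active user, the gain of the desired signal and the three factors of
  the residual interference from each other active transmitter are independent, with the laws
  `Exp(1)`, `normSqLaw`, `quantErrLaw` and `leakLaw`. -/
  hasLaw : ∀ S, ∀ k ∈ S, ∀ m,
    HasLaw
      (fun h => (gain S k m h,
        fun i : {i // i ∈ S.erase k} => (normSq k i h, err k i h, leak S k i m h)))
      ((expMeasure 1).prod
        (Measure.pi fun _ : {i // i ∈ S.erase k} =>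
          p.normSqLaw.prod (p.quantErrLaw.prod p.leakLaw)))
      law

namespace Fading

variable {p : Params} {H : Type*} [MeasurableSpace H] (c : Fading p H)

/-- SINR of stream `m` at active user `k` when the pairs in `S` are active. -/
def sinr (S : Finset (Fin p.N)) (k : Fin p.N) (m : Fin p.d) (h : H) : ℝ :=
  p.α * c.gain S k m h /
    (p.sigma ^ 2 + ∑ i ∈ S.erase k, p.α * c.normSq k i h * c.err k i h * c.leak S k i m h)

open Classical in
/-- The number of bits served for user `k` in a slot with active set `S` and fading state `h`:
`(1 - |S|θ)` times the sum of the rates assigned to the streams, and `0` if `k` is not active. -/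
def service (S : Finset (Fin p.N)) (h : H) (k : Fin p.N) : ℝ :=
  if k ∈ S then
    (1 - S.card * p.θ) * ∑ m : Fin p.d, (if p.τ ≤ c.sinr S k m h then p.R else 0)
  else 0

end Fading

/-! ### Arrivals, slots and queues -/

/-- The law of the arrivals in one slot: nonnegative and bounded, independent across users. -/
structure Arrivals (N : ℕ) where
  law : Fin N → Measure ℝ
  isProb : ∀ k, IsProbabilityMeasure (law k)
  bounded : ∃ Amax : ℝ, ∀ k, ∀ᵐ x ∂(law k), 0 ≤ x ∧ x < Amax

/-- The vector of mean arrival rates. -/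
def Arrivals.mean {N : ℕ} (a : Arrivals N) (k : Fin N) : ℝ := ∫ x, x ∂(a.law k)

/-- What happens in one slot: the arrivals, the fading state and the coin of the scheduler. -/
abbrev Slot (p : Params) (H : Type*) := (Fin p.N → ℝ) × H × unitInterval

section Dynamics

variable {p : Params} {H : Type*} [MeasurableSpace H]

/-- The law of one slot. -/
def slotLaw (c : Fading p H) (a : Arrivals p.N) : Measure (Slot p H) :=
  (Measure.pi a.law).prod (c.law.prod (volume : Measure unitInterval))

instance (c : Fading p H) (a : Arrivals p.N) : IsProbabilityMeasure (slotLaw c a) := by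
  have := c.isProb
  have := a.isProb
  unfold slotLaw
  infer_instance

/-- The law of the whole evolution: the slots are i.i.d. -/
def pathLaw (c : Fading p H) (a : Arrivals p.N) : Measure (ℕ → Slot p H) :=
  Measure.infinitePi (fun _ : ℕ => slotLaw c a)

/-- `q(t+1) = max (q(t) - B(t)) 0 + A(t)`, with the active set `S` in slot `t`. -/
def step (c : Fading p H) (q : Fin p.N → ℝ) (S : Finset (Fin p.N)) (x : Slot p H) :
    Fin p.N → ℝ :=
  fun k => max (q k - c.service S x.2.1 k) 0 + x.1 k

/-- A centralized scheduling policy: at the beginning of each slot the active set is chosen as a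
function of the current queue lengths and of a fresh coin (uniform on `[0,1]`). -/
structure Policy (p : Params) where
  choose : (Fin p.N → ℝ) → unitInterval → Finset (Fin p.N)
  measurable : ∀ S, MeasurableSet {x : (Fin p.N → ℝ) × unitInterval | choose x.1 x.2 = S}

/-- The queue lengths under a policy, started from `q0`. -/
def Policy.queue (π : Policy p) (c : Fading p H) (q0 : Fin p.N → ℝ) :
    ℕ → (ℕ → Slot p H) → Fin p.N → ℝ
  | 0, _ => q0
  | t + 1, ω =>
    step c (π.queue c q0 t ω) (π.choose (π.queue c q0 t ω) (ω t).2.2) (ω t)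

/-- An arbitrary causal scheduling policy: the active set in slot `t` may depend on everything that
happened in the slots before `t` and on a fresh coin. -/
structure CausalPolicy (p : Params) (H : Type*) [MeasurableSpace H] where
  choose : (t : ℕ) → (Fin t → Slot p H) → unitInterval → Finset (Fin p.N)
  measurable : ∀ t S, MeasurableSet {x : (Fin t → Slot p H) × unitInterval | choose t x.1 x.2 = S}

/-- The queue lengths under a causal policy, started from `q0`. -/
def CausalPolicy.queue (π : CausalPolicy p H) (c : Fading p H) (q0 : Fin p.N → ℝ) :
    ℕ → (ℕ → Slot p H) → Fin p.N → ℝ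
  | 0, _ => q0
  | t + 1, ω =>
    step c (π.queue c q0 t ω) (π.choose t (fun i => ω i) (ω t).2.2) (ω t)

/-- Strong stability: `limsup_T (1/T) ∑_{t<T} E q_k(t) < ∞` for every `k`. -/
def StronglyStable {Ω : Type*} [MeasurableSpace Ω] (μ : Measure Ω) {N : ℕ}
    (q : ℕ → Ω → Fin N → ℝ) : Prop :=
  ∀ k, limsup (fun T : ℕ =>
    (∑ t ∈ Finset.range T, ∫⁻ ω, ENNReal.ofReal (q t ω k) ∂μ) / (T : ℝ≥0∞)) atTop < ⊤

/-- The stability region: the mean arrival rate vectors for which some centralized policy makes all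
queues strongly stable, whatever the arrival law with this mean and the initial queue lengths. -/
def stabilityRegion (c : Fading p H) : Set (Fin p.N → ℝ) :=
  {a | 0 ≤ a ∧ ∃ π : Policy p, ∀ A : Arrivals p.N, A.mean = a → ∀ q0 : Fin p.N → ℝ, 0 ≤ q0 →
    StronglyStable (pathLaw c A) (π.queue c q0)}

end Dynamics

end SymIA

end

/-!
Since the desired gain is exponential, conditioning on the interferers turns the success
probability of a stream into a product of Laplace transforms, one per interferer. Integrating out
`‖h‖²` and then `e` leaves `(1 + τ Z / 2^(B/Q))^(-Q)`, and the binomial series and the Beta moments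
of `Z` evaluate its mean as `F`. So an active set `S` gives each of its users the average rate
`r |S|`, whatever the joint law of the fading, and time sharing between active sets gives the convex
hull of these points. The active sets with more than `L_I` pairs are redundant in it: averaging
over the subsets of size `L_I` of a set `S` gives its users the rate `L_I r(L_I) / |S|` each, which
is at least `r |S|` by the choice of `L_I`.

Under a strongly stable causal policy the expected queues are `o(T)` along some sequence of slots
`T`, so the arrivals up to `T` are matched, up to `o(T)`, by the expected service, which is `T`
times a point of the hull. Conversely, if the hull contains `a` with every coordinate increased by
some `ε > 0`, then choosing the active set by the coin alone, with the weights of that point, gives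
the quadratic Lyapunov function a drift of at most a constant minus `2 ε` times the expected queue.
-/

namespace SymIA

/-! ### Laplace transforms and moments -/

section Laplace

theorem lintegral_pi_prod {ι : Type*} [Fintype ι] {X : ι → Type*} [∀ i, MeasurableSpace (X i)]
    (μ : ∀ i, Measure (X i)) [∀ i, IsProbabilityMeasure (μ i)] {f : ∀ i, X i → ℝ≥0∞}
    (hf : ∀ i, Measurable (f i)) :
    ∫⁻ x, ∏ i, f i (x i) ∂(Measure.pi μ) = ∏ i, ∫⁻ x, f i x ∂(μ i) := by
  rw [lintegral_prod_eq_prod_lintegral_of_indepFun Finset.univ (fun i (x : ∀ i, X i) => f i (x i))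
    (iIndepFun_pi fun i => (hf i).aemeasurable) fun i => (hf i).comp (measurable_pi_apply i)]
  exact Finset.prod_congr rfl fun i _ => (measurePreserving_eval μ i).lintegral_comp (hf i)

theorem lintegral_exp_neg_mul_sq_gaussianReal (v : NNReal) {s : ℝ} (hs : 0 ≤ s) :
    ∫⁻ x, ENNReal.ofReal (Real.exp (-(s * x ^ 2))) ∂(gaussianReal 0 v) =
      ENNReal.ofReal (√(1 + 2 * v * s))⁻¹ := by
  rcases eq_or_ne v 0 with rfl | hv
  · simp [lintegral_dirac]
  have hrate : 0 < (2 * v : ℝ)⁻¹ + s := by positivity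
  have hdensity (x : ℝ) : gaussianPDF 0 v x * ENNReal.ofReal (Real.exp (-(s * x ^ 2))) =
      ENNReal.ofReal ((√(2 * Real.pi * v))⁻¹ * Real.exp (-((2 * v : ℝ)⁻¹ + s) * x ^ 2)) := by
    rw [gaussianPDF_def, ← ENNReal.ofReal_mul (gaussianPDFReal_nonneg _ _ _), gaussianPDFReal,
      mul_assoc, ← Real.exp_add]
    congr 3
    ring
  rw [gaussianReal_of_var_ne_zero _ hv,
    lintegral_withDensity_eq_lintegral_mul _ (measurable_gaussianPDF _ _) (by fun_prop)]
  simp_rw [Pi.mul_apply, hdensity]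
  rw [← ofReal_integral_eq_lintegral_ofReal ((integrable_exp_neg_mul_sq hrate).const_mul _)
    (ae_of_all _ fun x => by positivity), integral_const_mul, integral_gaussian,
    ← Real.sqrt_inv, ← Real.sqrt_inv, ← Real.sqrt_mul (by positivity)]
  congr 2
  field_simp

theorem measurable_complex_mk : Measurable fun z : ℝ × ℝ => (⟨z.1, z.2⟩ : ℂ) :=
  Complex.measurableEquivRealProd.symm.measurable

namespace Params

instance : IsProbabilityMeasure complexGaussian :=
  Measure.isProbabilityMeasure_map measurable_complex_mk.aemeasurable

theorem lintegral_exp_neg_mul_sq_complexGaussian {s : ℝ} (hs : 0 ≤ s) :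
    ∫⁻ z, ENNReal.ofReal (Real.exp (-(s * ‖z‖ ^ 2))) ∂complexGaussian =
      ENNReal.ofReal (1 + s)⁻¹ := by
  have hsplit (z : ℝ × ℝ) : ENNReal.ofReal (Real.exp (-(s * ‖(⟨z.1, z.2⟩ : ℂ)‖ ^ 2))) =
      ENNReal.ofReal (Real.exp (-(s * z.1 ^ 2))) * ENNReal.ofReal (Real.exp (-(s * z.2 ^ 2))) := by
    rw [← ENNReal.ofReal_mul (Real.exp_pos _).le, ← Real.exp_add, ← Complex.normSq_eq_norm_sq,
      Complex.normSq_mk]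
    ring_nf
  rw [complexGaussian, lintegral_map (by fun_prop) measurable_complex_mk]
  simp_rw [hsplit]
  rw [lintegral_prod_mul (f := fun x : ℝ => ENNReal.ofReal (Real.exp (-(s * x ^ 2))))
    (g := fun x : ℝ => ENNReal.ofReal (Real.exp (-(s * x ^ 2)))) (by fun_prop) (by fun_prop),
    lintegral_exp_neg_mul_sq_gaussianReal _ hs, ← ENNReal.ofReal_mul (by positivity), ← mul_inv,
    Real.mul_self_sqrt (by positivity)]
  norm_num

variable (p : Params)

theorem one_le_Q : 1 ≤ p.Q := Nat.le_sub_of_add_le p.antennas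

theorem card_antennas : Fintype.card (Fin p.Nr × Fin p.Nt) = p.Q + 1 := by
  have := p.antennas
  rw [Fintype.card_prod, Fintype.card_fin, Fintype.card_fin, mul_comm, Q]
  omega

theorem measurable_sum_norm_sq :
    Measurable fun h : Fin p.Nr × Fin p.Nt → ℂ => ∑ i, ‖h i‖ ^ 2 := by fun_prop

instance : IsProbabilityMeasure p.normSqLaw :=
  Measure.isProbabilityMeasure_map p.measurable_sum_norm_sq.aemeasurable

theorem ae_nonneg_normSqLaw : ∀ᵐ x ∂p.normSqLaw, 0 ≤ x := by
  rw [normSqLaw, ae_map_iff p.measurable_sum_norm_sq.aemeasurable measurableSet_Ici]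
  exact ae_of_all _ fun h => by positivity

theorem lintegral_exp_neg_mul_normSqLaw {s : ℝ} (hs : 0 ≤ s) :
    ∫⁻ x, ENNReal.ofReal (Real.exp (-(s * x))) ∂p.normSqLaw =
      ENNReal.ofReal ((1 + s) ^ (p.Q + 1))⁻¹ := by
  have hprod (h : Fin p.Nr × Fin p.Nt → ℂ) : ENNReal.ofReal (Real.exp (-(s * ∑ i, ‖h i‖ ^ 2))) =
      ∏ i, ENNReal.ofReal (Real.exp (-(s * ‖h i‖ ^ 2))) := by
    rw [← ENNReal.ofReal_prod_of_nonneg fun _ _ => (Real.exp_pos _).le, ← Real.exp_sum,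
      Finset.mul_sum, Finset.sum_neg_distrib]
  rw [normSqLaw, lintegral_map (by fun_prop) p.measurable_sum_norm_sq]
  simp_rw [hprod]
  rw [lintegral_pi_prod (f := fun _ (z : ℂ) => ENNReal.ofReal (Real.exp (-(s * ‖z‖ ^ 2)))) _
    fun _ => by fun_prop]
  simp_rw [lintegral_exp_neg_mul_sq_complexGaussian hs]
  rw [Finset.prod_const, Finset.card_univ, card_antennas, ← ENNReal.ofReal_pow (by positivity),
    inv_pow]

end Params

theorem hasDerivAt_div_one_add_mul_pow (n : ℕ) {s x : ℝ} (hx : 1 + s * x ≠ 0) :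
    HasDerivAt (fun x => (x / (1 + s * x)) ^ n)
      (n * x ^ (n - 1) * ((1 + s * x) ^ (n + 1))⁻¹) x := by
  have hden : HasDerivAt (fun x => 1 + s * x) s x := by
    simpa using ((hasDerivAt_id x).const_mul s).const_add 1
  refine (((hasDerivAt_id x).div hden hx).pow n).congr_deriv ?_
  rcases n with _ | n
  · simp
  · simp only [id, Nat.add_sub_cancel, div_pow, Pi.div_apply]
    push_cast
    field_simp
    ring

theorem setLIntegral_Icc_mul_inv_pow {n : ℕ} (hn : n ≠ 0) {s x : ℝ} (hs : 0 ≤ s) (hx : 0 ≤ x) :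
    ∫⁻ ε in Set.Icc 0 x, ENNReal.ofReal (n * ε ^ (n - 1) * ((1 + s * ε) ^ (n + 1))⁻¹) =
      ENNReal.ofReal ((x / (1 + s * x)) ^ n) := by
  have hcont : ContinuousOn (fun ε : ℝ => n * ε ^ (n - 1) * ((1 + s * ε) ^ (n + 1))⁻¹)
      (Set.Icc 0 x) := by
    refine ContinuousOn.mul (by fun_prop) (ContinuousOn.inv₀ (by fun_prop) fun ε hε => ?_)
    have := hε.1
    positivity
  have hnonneg : 0 ≤ᵐ[volume.restrict (Set.Icc 0 x)]
      fun ε : ℝ => n * ε ^ (n - 1) * ((1 + s * ε) ^ (n + 1))⁻¹ := by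
    filter_upwards [ae_restrict_mem measurableSet_Icc] with ε hε
    have := hε.1
    simp only [Pi.zero_apply]
    positivity
  rw [← ofReal_integral_eq_lintegral_ofReal hcont.integrableOn_Icc hnonneg,
    integral_Icc_eq_integral_Ioc, ← intervalIntegral.integral_of_le hx,
    intervalIntegral.integral_eq_sub_of_hasDerivAt (f := fun ε : ℝ => (ε / (1 + s * ε)) ^ n)]
  · simp [hn]
  · intro ε hε
    rw [Set.uIcc_of_le hx] at hε
    have := hε.1
    exact hasDerivAt_div_one_add_mul_pow n (by positivity)
  · exact (intervalIntegrable_iff_integrableOn_Icc_of_le hx).2 hcont.integrableOn_Icc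

namespace Params

variable (p : Params)

theorem δ_pos : 0 < p.δ := Real.rpow_pos_of_pos two_pos _

theorem δ_pow_Q : p.δ ^ p.Q = 2 ^ p.B := by
  have := p.one_le_Q
  rw [δ, ← Real.rpow_natCast, ← Real.rpow_mul two_pos.le, div_mul_cancel₀ _ (by positivity),
    Real.rpow_natCast]

theorem lintegral_inv_pow_quantErrLaw {s : ℝ} (hs : 0 ≤ s) :
    ∫⁻ ε, ENNReal.ofReal ((1 + s * ε) ^ (p.Q + 1))⁻¹ ∂p.quantErrLaw =
      ENNReal.ofReal ((1 + s / p.δ) ^ p.Q)⁻¹ := by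
  have hδ := p.δ_pos
  have hdensity : ∀ ε ∈ Set.Icc 0 (p.δ)⁻¹,
      ENNReal.ofReal (2 ^ p.B * p.Q * ε ^ (p.Q - 1)) *
        ENNReal.ofReal ((1 + s * ε) ^ (p.Q + 1))⁻¹ =
      ENNReal.ofReal (2 ^ p.B) *
        ENNReal.ofReal (p.Q * ε ^ (p.Q - 1) * ((1 + s * ε) ^ (p.Q + 1))⁻¹) := by
    intro ε hε
    have := hε.1
    rw [← ENNReal.ofReal_mul (by positivity), ← ENNReal.ofReal_mul (by positivity)]
    ring_nf
  rw [quantErrLaw, lintegral_withDensity_eq_lintegral_mul _ (by fun_prop) (by fun_prop)]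
  simp only [Pi.mul_apply]
  rw [setLIntegral_congr_fun measurableSet_Icc hdensity, lintegral_const_mul _ (by fun_prop),
    setLIntegral_Icc_mul_inv_pow (Nat.one_le_iff_ne_zero.1 p.one_le_Q) hs (inv_nonneg.2 hδ.le),
    ← ENNReal.ofReal_mul (by positivity), ← p.δ_pow_Q, ← mul_pow, ← inv_pow]
  congr 2
  field_simp

instance : IsProbabilityMeasure p.quantErrLaw :=
  ⟨by simpa using p.lintegral_inv_pow_quantErrLaw le_rfl⟩

theorem ae_nonneg_quantErrLaw : ∀ᵐ ε ∂p.quantErrLaw, 0 ≤ ε :=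
  (withDensity_absolutelyContinuous _ _).ae_le
    ((ae_restrict_mem measurableSet_Icc).mono fun _ hε => hε.1)

end Params

theorem ascPochhammer_eval_mul_Gamma {x : ℝ} (hx : 0 < x) (n : ℕ) :
    (ascPochhammer ℝ n).eval x * Real.Gamma x = Real.Gamma (x + n) := by
  induction n with
  | zero => simp
  | succ n ih =>
    rw [ascPochhammer_succ_eval, mul_right_comm, ih, Nat.cast_succ, ← add_assoc,
      Real.Gamma_add_one (by positivity), mul_comm]

theorem beta_add_nat_div_beta {a b : ℝ} (ha : 0 < a) (hb : 0 < b) (n : ℕ) :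
    beta a (b + n) / beta a b =
      (ascPochhammer ℝ n).eval b * ((ascPochhammer ℝ n).eval (a + b))⁻¹ := by
  have hab := add_pos ha hb
  have hΓa := (Real.Gamma_pos_of_pos ha).ne'
  have hΓb := (Real.Gamma_pos_of_pos hb).ne'
  have hΓab := (Real.Gamma_pos_of_pos hab).ne'
  have hpoch := (ascPochhammer_pos n _ hab).ne'
  rw [beta, beta, ← add_assoc, ← ascPochhammer_eval_mul_Gamma hb,
    ← ascPochhammer_eval_mul_Gamma hab]
  field_simp

theorem measurable_betaPDF (a b : ℝ) : Measurable (betaPDF a b) :=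
  (measurable_betaPDFReal a b).ennreal_ofReal

theorem ae_mem_Ioo_betaMeasure (a b : ℝ) : ∀ᵐ y ∂(betaMeasure a b), y ∈ Set.Ioo 0 1 := by
  refine (ae_withDensity_iff (measurable_betaPDF a b)).2 (ae_of_all _ fun y hy => ?_)
  by_contra h
  rw [Set.mem_Ioo] at h
  exact hy (by rw [betaPDF_eq, if_neg h, ENNReal.ofReal_zero])

theorem lintegral_one_sub_pow_betaMeasure {a b : ℝ} (ha : 0 < a) (hb : 0 < b) (n : ℕ) :
    ∫⁻ y, ENNReal.ofReal ((1 - y) ^ n) ∂(betaMeasure a b) =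
      ENNReal.ofReal ((ascPochhammer ℝ n).eval b * ((ascPochhammer ℝ n).eval (a + b))⁻¹) := by
  have hbn : 0 < b + n := by positivity
  have hshift (y : ℝ) : betaPDF a b y * ENNReal.ofReal ((1 - y) ^ n) =
      ENNReal.ofReal (beta a (b + n) / beta a b) * betaPDF a (b + n) y := by
    have hβ := beta_pos ha hb
    have hβn := beta_pos ha hbn
    rw [betaPDF_eq, betaPDF_eq]
    split_ifs with hy
    · have hy₀ := hy.1
      have hy₁ : 0 < 1 - y := sub_pos.2 hy.2
      rw [← ENNReal.ofReal_mul (by positivity), ← ENNReal.ofReal_mul (by positivity),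
        add_sub_right_comm, Real.rpow_add_natCast hy₁.ne']
      congr 1
      field_simp
    · simp
  rw [betaMeasure, lintegral_withDensity_eq_lintegral_mul _ (measurable_betaPDF a b)
    (by fun_prop), ← beta_add_nat_div_beta ha hb]
  simp_rw [Pi.mul_apply, hshift]
  rw [lintegral_const_mul _ (measurable_betaPDF _ _), lintegral_betaPDF_eq_one ha hbn, mul_one]

theorem hasSum_ascPochhammer_mul_pow (s : ℝ) {u : ℝ} (hu : |u| < 1) :
    HasSum (fun n : ℕ => (n.factorial : ℝ)⁻¹ * (ascPochhammer ℝ n).eval s * u ^ n)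
      ((1 - u) ^ (-s)) := by
  have hball : u ∈ Metric.eball (0 : ℝ) 1 := by
    rw [← ENNReal.ofReal_one, Metric.eball_ofReal]
    simpa using hu
  have h := (Real.one_div_one_sub_rpow_hasFPowerSeriesOnBall_zero s).hasSum hball
  have hcoeff (n : ℕ) : Ring.choose (s + n - 1) n =
      (n.factorial : ℝ)⁻¹ * (ascPochhammer ℝ n).eval s := by
    rw [← Ring.multichoose_eq, ← Polynomial.ascPochhammer_smeval_eq_eval,
      ← Ring.factorial_nsmul_multichoose_eq_ascPochhammer, nsmul_eq_mul,
      inv_mul_cancel_left₀ (by positivity)]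
  simpa only [FormalMultilinearSeries.ofScalars_apply_eq, hcoeff, smul_eq_mul, zero_add, one_div,
    ← Real.rpow_neg (sub_nonneg.2 ((le_abs_self u).trans hu.le))] using h

theorem hasSum_ordinaryHypergeometric {a b c : ℝ} (ha : 0 < a) (hb : 0 < b) (hc : 0 < c) {z : ℝ}
    (hz : |z| < 1) :
    HasSum (fun n => ordinaryHypergeometricCoefficient a b c n * z ^ n)
      (ordinaryHypergeometric a b c z) := by
  have hne {x : ℝ} (hx : 0 < x) (k : ℕ) : (k : ℝ) ≠ -x := by
    have := k.cast_nonneg (α := ℝ)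
    linarith
  have hradius := ordinaryHypergeometricSeries_radius_eq_one ℝ a b c
    fun k => ⟨hne ha k, hne hb k, hne hc k⟩
  have hball : z ∈ Metric.eball (0 : ℝ) (ordinaryHypergeometricSeries ℝ a b c).radius := by
    rw [hradius, ← ENNReal.ofReal_one, Metric.eball_ofReal]
    simpa using hz
  simpa only [ordinaryHypergeometricSeries_apply_eq, smul_eq_mul, ordinaryHypergeometricCoefficient,
    ordinaryHypergeometric] using (ordinaryHypergeometricSeries ℝ a b c).hasSum hball

/-- This is the binomial series after the substitution
`1 + x * y = (1 + x) * (1 - x / (1 + x) * (1 - y))`, which makes every term nonnegative. -/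
theorem hasSum_one_add_mul_rpow_neg (s : ℝ) {x y : ℝ} (hx : 0 ≤ x) (hy : y ∈ Set.Ioo 0 1) :
    HasSum (fun n : ℕ => (1 + x) ^ (-s) * ((n.factorial : ℝ)⁻¹ * (ascPochhammer ℝ n).eval s *
      (x / (1 + x)) ^ n) * (1 - y) ^ n) ((1 + x * y) ^ (-s)) := by
  obtain ⟨hy₀, hy₁⟩ := hy
  have hu₀ : 0 ≤ x / (1 + x) * (1 - y) := mul_nonneg (by positivity) (by linarith)
  have hu₁ : x / (1 + x) * (1 - y) < 1 := by
    rw [div_mul_eq_mul_div, div_lt_one (by positivity)]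
    nlinarith
  have hsum := (hasSum_ascPochhammer_mul_pow s (abs_lt.2 ⟨by linarith, hu₁⟩)).mul_left
    ((1 + x) ^ (-s))
  rw [← Real.mul_rpow (by positivity) (by linarith)] at hsum
  convert! hsum using 2
  · rw [mul_pow]
    ring
  · field_simp
    ring

theorem lintegral_one_add_mul_rpow_neg_betaMeasure {a b s x : ℝ} (ha : 0 < a) (hb : 0 < b)
    (hs : 0 < s) (hx : 0 ≤ x) :
    ∫⁻ y, ENNReal.ofReal ((1 + x * y) ^ (-s)) ∂(betaMeasure a b) =
      ENNReal.ofReal ((1 + x) ^ (-s) * ordinaryHypergeometric b s (a + b) (x / (1 + x))) := by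
  set z := x / (1 + x) with hz
  have hz₀ : 0 ≤ z := by positivity
  have hz₁ : z < 1 := by rw [hz, div_lt_one (by positivity)]; linarith
  set coeff : ℕ → ℝ := fun n =>
    (1 + x) ^ (-s) * ((n.factorial : ℝ)⁻¹ * (ascPochhammer ℝ n).eval s * z ^ n)
  have hcoeff (n : ℕ) : 0 ≤ coeff n := by
    have := ascPochhammer_pos n _ hs
    positivity
  have hbinomial : ∀ y ∈ Set.Ioo (0 : ℝ) 1, ENNReal.ofReal ((1 + x * y) ^ (-s)) =
      ∑' n, ENNReal.ofReal (coeff n) * ENNReal.ofReal ((1 - y) ^ n) := by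
    intro y hy
    have hsum := hasSum_one_add_mul_rpow_neg s hx hy
    rw [← hsum.tsum_eq, ENNReal.ofReal_tsum_of_nonneg (fun n => ?_) hsum.summable]
    · exact tsum_congr fun n => ENNReal.ofReal_mul (hcoeff n)
    · exact mul_nonneg (hcoeff n) (pow_nonneg (sub_nonneg.2 hy.2.le) n)
  have hmoment (n : ℕ) : ∫⁻ y, ENNReal.ofReal (coeff n) * ENNReal.ofReal ((1 - y) ^ n)
      ∂(betaMeasure a b) = ENNReal.ofReal
        ((1 + x) ^ (-s) * (ordinaryHypergeometricCoefficient b s (a + b) n * z ^ n)) := by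
    rw [lintegral_const_mul _ (by fun_prop), lintegral_one_sub_pow_betaMeasure ha hb,
      ← ENNReal.ofReal_mul (hcoeff n)]
    congr 1
    ring
  have hF := (hasSum_ordinaryHypergeometric hb hs (add_pos ha hb)
    (abs_lt.2 ⟨by linarith, hz₁⟩)).mul_left ((1 + x) ^ (-s))
  rw [lintegral_congr_ae ((ae_mem_Ioo_betaMeasure a b).mono hbinomial),
    lintegral_tsum fun n => by fun_prop, tsum_congr hmoment, ← hF.tsum_eq,
    ENNReal.ofReal_tsum_of_nonneg (fun n => ?_) hF.summable]
  have := ascPochhammer_pos n _ hb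
  have := ascPochhammer_pos n _ hs
  have := ascPochhammer_pos n _ (add_pos ha hb)
  positivity

end Laplace

/-! ### The success probability of a stream -/

section Success

theorem expMeasure_Ici {r x : ℝ} (hr : 0 < r) (hx : 0 ≤ x) :
    expMeasure r (Set.Ici x) = ENNReal.ofReal (Real.exp (-(r * x))) := by
  have := isProbabilityMeasure_expMeasure hr
  have hatom : expMeasure r {x} = 0 := withDensity_absolutelyContinuous _ _ (measure_singleton x)
  have hexp : Real.exp (-(r * x)) ≤ 1 := Real.exp_le_one_iff.2 (by nlinarith)
  rw [measure_congr (Ioi_ae_eq_Ici' hatom).symm, ← Set.compl_Iic,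
    prob_compl_eq_one_sub measurableSet_Iic, ← ofReal_cdf, cdf_expMeasure_eq hr, if_pos hx,
    ← ENNReal.ofReal_one, ← ENNReal.ofReal_sub _ (sub_nonneg.2 hexp), sub_sub_cancel]

theorem expMeasure_prod_setOf_add_le {Ω : Type*} [MeasurableSpace Ω] {μ : Measure Ω} [SFinite μ]
    {r x : ℝ} (hr : 0 < r) (hx : 0 ≤ x) {I : Ω → ℝ} (hI : Measurable I) (hI₀ : 0 ≤ᵐ[μ] I) :
    ((expMeasure r).prod μ) {z | x + I z.2 ≤ z.1} = ENNReal.ofReal (Real.exp (-(r * x))) *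
      ∫⁻ ω, ENNReal.ofReal (Real.exp (-(r * I ω))) ∂μ := by
  have := isProbabilityMeasure_expMeasure hr
  have hslice : ∀ᵐ ω ∂μ, expMeasure r ((fun g => (g, ω)) ⁻¹' {z | x + I z.2 ≤ z.1}) =
      ENNReal.ofReal (Real.exp (-(r * x))) * ENNReal.ofReal (Real.exp (-(r * I ω))) := by
    filter_upwards [hI₀] with ω hω
    rw [← ENNReal.ofReal_mul (Real.exp_pos _).le, ← Real.exp_add, ← neg_add, ← mul_add,
      ← expMeasure_Ici hr (add_nonneg hx hω)]
    rfl
  rw [Measure.prod_apply_symm (measurableSet_le (by fun_prop) (by fun_prop)),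
    lintegral_congr_ae hslice, lintegral_const_mul _ (by fun_prop)]

theorem ordinaryHypergeometric_zero_left (b c z : ℝ) : ordinaryHypergeometric 0 b c z = 1 := by
  rw [ordinaryHypergeometric_eq_tsum]
  refine (tsum_eq_single 0 fun n hn => ?_).trans (by simp)
  simp [ascPochhammer_ne_zero_eval_zero ℝ hn]

namespace Params

variable (p : Params)

theorem α_pos : 0 < p.α :=
  div_pos (mul_pos p.P_pos p.ζ_pos) (Nat.cast_pos.2 p.d_pos)

theorem betaA_pos : 0 < p.betaA := by
  have hQ : (1 : ℝ) ≤ p.Q := by exact_mod_cast p.one_le_Q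
  have hd : (1 : ℝ) ≤ p.d := by exact_mod_cast p.d_pos
  rw [betaA, ← sub_div]
  exact div_pos (by nlinarith) (by linarith)

theorem betaB_pos (h : p.Q ≠ 1) : 0 < p.betaB := by
  have hQ : (1 : ℝ) < p.Q := by exact_mod_cast lt_of_le_of_ne p.one_le_Q h.symm
  exact mul_pos (by linarith) p.betaA_pos

instance : IsProbabilityMeasure p.leakLaw := by
  rw [leakLaw]
  split_ifs with h
  · exact Measure.isProbabilityMeasure_map (by fun_prop)
  · have := isProbabilityMeasureBeta p.betaA_pos (p.betaB_pos h)
    exact Measure.isProbabilityMeasure_map (by fun_prop)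

theorem ae_nonneg_leakLaw : ∀ᵐ z ∂p.leakLaw, 0 ≤ z := by
  rw [leakLaw, ae_map_iff (by fun_prop) measurableSet_Ici]
  split_ifs with h
  · rw [ae_dirac_iff (measurableSet_le (by fun_prop) (by fun_prop))]
    positivity
  · filter_upwards [ae_mem_Ioo_betaMeasure p.betaA p.betaB] with y hy
    exact mul_nonneg (Nat.cast_nonneg _) hy.1.le

theorem F_eq : p.F = (1 + p.d * p.τ / p.δ) ^ (-(p.Q : ℝ)) *
    ordinaryHypergeometric p.betaB (p.Q : ℝ) (p.betaA + p.betaB)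
      (p.d * p.τ / p.δ / (1 + p.d * p.τ / p.δ)) := by
  have hd : (0 : ℝ) < p.d := Nat.cast_pos.2 p.d_pos
  have hδ := p.δ_pos
  have hτ := p.τ_pos
  rw [F, zpow_neg, zpow_natCast, Real.rpow_neg (by positivity), Real.rpow_natCast,
    add_comm (1 : ℝ)]
  congr 2
  field_simp
  ring

theorem lintegral_inv_pow_leakLaw :
    ∫⁻ z, ENNReal.ofReal ((1 + p.τ / p.δ * z) ^ p.Q)⁻¹ ∂p.leakLaw = ENNReal.ofReal p.F := by
  have hδ := p.δ_pos
  have hτ := p.τ_pos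
  have hQ : (0 : ℝ) < p.Q := Nat.cast_pos.2 p.one_le_Q
  rw [leakLaw, lintegral_map (by fun_prop) (by fun_prop), F_eq]
  simp_rw [← mul_assoc, div_mul_eq_mul_div, mul_comm p.τ]
  split_ifs with h
  · rw [lintegral_dirac' _ (by fun_prop), betaB, h, Nat.cast_one, sub_self, zero_mul,
      ordinaryHypergeometric_zero_left, mul_one, mul_one, pow_one, Real.rpow_neg_one]
  · rw [← lintegral_one_add_mul_rpow_neg_betaMeasure p.betaA_pos (p.betaB_pos h) hQ
      (by positivity)]
    refine lintegral_congr_ae ((ae_mem_Ioo_betaMeasure _ _).mono fun y hy => ?_)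
    have hy₀ := hy.1
    beta_reduce
    rw [Real.rpow_neg (by positivity), Real.rpow_natCast, div_mul_eq_mul_div]

/-- The law of the three factors `‖h‖²`, `e`, `Z` of the residual interference from one active
transmitter. -/
noncomputable abbrev interfererLaw : Measure (ℝ × ℝ × ℝ) :=
  p.normSqLaw.prod (p.quantErrLaw.prod p.leakLaw)

theorem ae_nonneg_interfererLaw : ∀ᵐ w ∂p.interfererLaw, 0 ≤ w.1 * w.2.1 * w.2.2 := by
  filter_upwards [Measure.quasiMeasurePreserving_fst.ae p.ae_nonneg_normSqLaw,
    Measure.quasiMeasurePreserving_snd.ae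
      (Measure.quasiMeasurePreserving_fst.ae p.ae_nonneg_quantErrLaw),
    Measure.quasiMeasurePreserving_snd.ae
      (Measure.quasiMeasurePreserving_snd.ae p.ae_nonneg_leakLaw)] with w hw₁ hw₂ hw₃
  exact mul_nonneg (mul_nonneg hw₁ hw₂) hw₃

theorem lintegral_exp_neg_interfererLaw :
    ∫⁻ w, ENNReal.ofReal (Real.exp (-(p.τ * (w.1 * w.2.1 * w.2.2)))) ∂p.interfererLaw =
      ENNReal.ofReal p.F := by
  have hτ := p.τ_pos
  have hnormSq : ∀ᵐ v ∂(p.quantErrLaw.prod p.leakLaw),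
      ∫⁻ x, ENNReal.ofReal (Real.exp (-(p.τ * (x * v.1 * v.2)))) ∂p.normSqLaw =
        ENNReal.ofReal ((1 + p.τ * v.2 * v.1) ^ (p.Q + 1))⁻¹ := by
    filter_upwards [Measure.quasiMeasurePreserving_fst.ae p.ae_nonneg_quantErrLaw,
      Measure.quasiMeasurePreserving_snd.ae p.ae_nonneg_leakLaw] with v hv₁ hv₂
    rw [← p.lintegral_exp_neg_mul_normSqLaw (by positivity)]
    refine lintegral_congr fun x => ?_
    congr 3
    ring
  rw [interfererLaw, lintegral_prod_symm' _ (by fun_prop), lintegral_congr_ae hnormSq,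
    lintegral_prod_symm' _ (by fun_prop), ← p.lintegral_inv_pow_leakLaw]
  refine lintegral_congr_ae (p.ae_nonneg_leakLaw.mono fun z hz => ?_)
  beta_reduce
  rw [p.lintegral_inv_pow_quantErrLaw (mul_nonneg hτ.le hz), div_mul_eq_mul_div]

theorem F_pos : 0 < p.F := by
  rw [← ENNReal.ofReal_pos, ← p.lintegral_exp_neg_interfererLaw, lintegral_pos_iff_support
    (by fun_prop), Function.support_eq_univ fun _ =>
      (ENNReal.ofReal_pos.2 (Real.exp_pos _)).ne', measure_univ]
  exact one_pos

theorem F_le_one : p.F ≤ 1 := by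
  rw [← ENNReal.ofReal_le_one, ← p.lintegral_exp_neg_interfererLaw]
  calc _ ≤ ∫⁻ _, 1 ∂p.interfererLaw := by
        refine lintegral_mono_ae (p.ae_nonneg_interfererLaw.mono fun w hw => ?_)
        rw [ENNReal.ofReal_le_one, Real.exp_le_one_iff, neg_nonpos]
        exact mul_nonneg p.τ_pos.le hw
    _ = 1 := by rw [lintegral_one, measure_univ]

section Pi

variable (ι : Type*) [Fintype ι]

theorem ae_nonneg_sum_interfererLaw :
    ∀ᵐ w ∂(Measure.pi fun _ : ι => p.interfererLaw), 0 ≤ ∑ i, (w i).1 * (w i).2.1 * (w i).2.2 := by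
  refine (ae_all_iff.2 fun i => ?_).mono fun w hw => Finset.sum_nonneg fun i _ => hw i
  exact (measurePreserving_eval (fun _ : ι => p.interfererLaw) i).quasiMeasurePreserving.ae
    p.ae_nonneg_interfererLaw

theorem lintegral_exp_neg_sum_interfererLaw :
    ∫⁻ w, ENNReal.ofReal (Real.exp (-(p.τ * ∑ i, (w i).1 * (w i).2.1 * (w i).2.2)))
      ∂(Measure.pi fun _ : ι => p.interfererLaw) = ENNReal.ofReal (p.F ^ Fintype.card ι) := by
  have hprod (w : ι → ℝ × ℝ × ℝ) :
      ENNReal.ofReal (Real.exp (-(p.τ * ∑ i, (w i).1 * (w i).2.1 * (w i).2.2))) =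
        ∏ i, ENNReal.ofReal (Real.exp (-(p.τ * ((w i).1 * (w i).2.1 * (w i).2.2)))) := by
    rw [← ENNReal.ofReal_prod_of_nonneg fun _ _ => (Real.exp_pos _).le, ← Real.exp_sum,
      Finset.mul_sum, Finset.sum_neg_distrib]
  simp_rw [hprod]
  rw [lintegral_pi_prod (fun _ => p.interfererLaw) (f := fun _ (w : ℝ × ℝ × ℝ) =>
    ENNReal.ofReal (Real.exp (-(p.τ * (w.1 * w.2.1 * w.2.2))))) fun _ => by fun_prop]
  simp_rw [p.lintegral_exp_neg_interfererLaw]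
  rw [Finset.prod_const, Finset.card_univ, ← ENNReal.ofReal_pow p.F_pos.le]

end Pi

end Params

namespace Fading

variable {p : Params} {H : Type*} [MeasurableSpace H] (c : Fading p H)

/-- The residual interference seen by stream `m` of user `k`, in units of the received power `α`. -/
def interference (S : Finset (Fin p.N)) (k : Fin p.N) (m : Fin p.d) (h : H) : ℝ :=
  ∑ i : {i // i ∈ S.erase k}, c.normSq k i h * c.err k i h * c.leak S k i m h

theorem le_sinr_iff {S : Finset (Fin p.N)} {k : Fin p.N} {m : Fin p.d} {h : H}
    (hI : 0 ≤ c.interference S k m h) :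
    p.τ ≤ c.sinr S k m h ↔
      p.sigma ^ 2 * p.τ / p.α + p.τ * c.interference S k m h ≤ c.gain S k m h := by
  have hα := p.α_pos
  have hσ := p.sigma_pos
  have hsum : ∑ i ∈ S.erase k, p.α * c.normSq k i h * c.err k i h * c.leak S k i m h =
      p.α * c.interference S k m h := by
    simp_rw [interference, mul_assoc, ← Finset.mul_sum]
    rw [← Finset.sum_coe_sort]
  rw [sinr, hsum, le_div_iff₀ (by positivity), div_add' _ _ _ hα.ne', div_le_iff₀ hα]
  ring_nf

theorem measurable_sinr (S : Finset (Fin p.N)) (k : Fin p.N) (m : Fin p.d) :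
    Measurable (c.sinr S k m) :=
  ((c.measurable_gain S k m).const_mul _).div <| (Finset.measurable_fun_sum _ fun i _ =>
    (((c.measurable_normSq k i).const_mul _).mul (c.measurable_err k i)).mul
      (c.measurable_leak S k i m)).const_add _

theorem law_setOf_le_sinr {S : Finset (Fin p.N)} {k : Fin p.N} (hk : k ∈ S) (m : Fin p.d) :
    c.law {h | p.τ ≤ c.sinr S k m h} =
      ENNReal.ofReal (Real.exp (-(p.sigma ^ 2 * p.τ / p.α)) * p.F ^ (S.card - 1)) := by
  have hα := p.α_pos
  have hτ := p.τ_pos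
  set total : ({i // i ∈ S.erase k} → ℝ × ℝ × ℝ) → ℝ :=
    fun w => ∑ i, (w i).1 * (w i).2.1 * (w i).2.2
  have htotal₀ := p.ae_nonneg_sum_interfererLaw {i // i ∈ S.erase k}
  have hlaw := c.hasLaw S k hk m
  have := isProbabilityMeasure_expMeasure one_pos
  have hI : ∀ᵐ h ∂c.law, 0 ≤ c.interference S k m h :=
    (hlaw.ae_iff (p := fun z => 0 ≤ total z.2)
      (measurableSet_setOfPred.1 (measurableSet_le (by fun_prop) (by fun_prop)))).2
      (Measure.quasiMeasurePreserving_snd.ae htotal₀)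
  calc c.law {h | p.τ ≤ c.sinr S k m h}
      = c.law {h | p.sigma ^ 2 * p.τ / p.α + p.τ * c.interference S k m h ≤ c.gain S k m h} :=
        measure_congr (hI.mono fun h hh => propext (c.le_sinr_iff hh))
    _ = ((expMeasure 1).prod (Measure.pi fun _ => p.interfererLaw))
          {z | p.sigma ^ 2 * p.τ / p.α + p.τ * total z.2 ≤ z.1} :=
        hlaw.measure_eq (p := fun z => p.sigma ^ 2 * p.τ / p.α + p.τ * total z.2 ≤ z.1)
          (measurableSet_le (by fun_prop) (by fun_prop))
    _ = _ := by
      rw [expMeasure_prod_setOf_add_le one_pos (by positivity) (by fun_prop)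
        (htotal₀.mono fun w hw => mul_nonneg hτ.le hw)]
      simp only [one_mul]
      rw [p.lintegral_exp_neg_sum_interfererLaw, Fintype.card_coe, Finset.card_erase_of_mem hk,
        ← ENNReal.ofReal_mul (Real.exp_pos _).le]

end Fading

end Success

/-! ### Average service rates -/

section Service

namespace Params

variable (p : Params)

/-- The vector of average service rates when the pairs in `S` are active: the point of
`I_{|S|}` whose support is `S`. -/
noncomputable def ratePoint (S : Finset (Fin p.N)) : Fin p.N → ℝ :=
  fun k => if k ∈ S then p.r S.card else 0

theorem one_sub_mul_θ_pos {L : ℕ} (hL : L ≤ p.N) : 0 < 1 - (L : ℝ) * p.θ := by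
  have hLN : (L : ℝ) * p.θ ≤ p.N * p.θ := by
    have := p.θ_pos
    gcongr
  linarith [p.Nθ_lt_one]

theorem card_le (S : Finset (Fin p.N)) : S.card ≤ p.N :=
  S.card_le_univ.trans_eq (Fintype.card_fin _)

theorem r_succ (L : ℕ) : p.r (L + 1) =
    (1 - (L + 1 : ℕ) * p.θ) * p.d * p.R * Real.exp (-(p.sigma ^ 2 * p.τ / p.α)) * p.F ^ L := by
  rw [r, Nat.cast_succ (R := ℤ), add_sub_cancel_right, zpow_natCast]

end Params

namespace Fading

variable {p : Params} {H : Type*} [MeasurableSpace H] (c : Fading p H)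

theorem measurable_service (S : Finset (Fin p.N)) (k : Fin p.N) :
    Measurable fun h => c.service S h k := by
  unfold service
  split_ifs
  · exact (Finset.measurable_fun_sum _ fun m _ => Measurable.ite
      (measurableSet_le measurable_const (c.measurable_sinr S k m))
      measurable_const measurable_const).const_mul _
  · exact measurable_const

theorem service_nonneg (S : Finset (Fin p.N)) (h : H) (k : Fin p.N) : 0 ≤ c.service S h k := by
  unfold service
  have hR := p.R_pos
  split_ifs
  · exact mul_nonneg (p.one_sub_mul_θ_pos (p.card_le S)).le
      (Finset.sum_nonneg fun m _ => by split_ifs <;> positivity)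
  · exact le_rfl

theorem service_le (S : Finset (Fin p.N)) (h : H) (k : Fin p.N) :
    c.service S h k ≤ p.d * p.R := by
  unfold service
  have hR := p.R_pos
  have hθ : 0 ≤ (S.card : ℝ) * p.θ := mul_nonneg (Nat.cast_nonneg _) p.θ_pos.le
  split_ifs
  · calc (1 - S.card * p.θ) * ∑ m : Fin p.d, (if p.τ ≤ c.sinr S k m h then p.R else 0)
        ≤ 1 * ∑ _m : Fin p.d, p.R := by
          gcongr with m
          · linarith
          · split_ifs <;> linarith
      _ = p.d * p.R := by rw [one_mul, Finset.sum_const, Finset.card_fin, nsmul_eq_mul]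
  · positivity

theorem lintegral_service (S : Finset (Fin p.N)) (k : Fin p.N) :
    ∫⁻ h, ENNReal.ofReal (c.service S h k) ∂c.law = ENNReal.ofReal (p.ratePoint S k) := by
  unfold service Params.ratePoint
  split_ifs with hk
  · have hR := p.R_pos
    have hθ := p.one_sub_mul_θ_pos (p.card_le S)
    have hmeas (m : Fin p.d) : MeasurableSet {h | p.τ ≤ c.sinr S k m h} :=
      measurableSet_le measurable_const (c.measurable_sinr S k m)
    have hsum (h : H) : ENNReal.ofReal ((1 - S.card * p.θ) *
        ∑ m : Fin p.d, (if p.τ ≤ c.sinr S k m h then p.R else 0)) =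
        ENNReal.ofReal (1 - S.card * p.θ) * ∑ m : Fin p.d,
          {h | p.τ ≤ c.sinr S k m h}.indicator (fun _ => ENNReal.ofReal p.R) h := by
      rw [ENNReal.ofReal_mul hθ.le,
        ENNReal.ofReal_sum_of_nonneg fun m _ => by split_ifs <;> positivity]
      simp only [Set.indicator_apply, Set.mem_ofPred_eq, apply_ite ENNReal.ofReal,
        ENNReal.ofReal_zero]
    obtain ⟨L, hL⟩ := Nat.exists_eq_add_one.2 (Finset.card_pos.2 ⟨k, hk⟩)
    simp_rw [hsum]
    rw [lintegral_const_mul _ (Finset.measurable_fun_sum _ fun m _ =>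
      measurable_const.indicator (hmeas m)),
      lintegral_finsetSum _ fun m _ => measurable_const.indicator (hmeas m)]
    simp_rw [lintegral_indicator_const (hmeas _), c.law_setOf_le_sinr hk]
    rw [Finset.sum_const, Finset.card_fin, nsmul_eq_mul,
      ← ENNReal.ofReal_natCast, ← ENNReal.ofReal_mul hR.le, ← ENNReal.ofReal_mul (by positivity),
      ← ENNReal.ofReal_mul hθ.le, hL, p.r_succ, Nat.add_sub_cancel]
    congr 1
    ring
  · rw [ENNReal.ofReal_zero, lintegral_zero]

end Fading

end Service

/-! ### Geometry of the rate region -/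

section Geometry

variable {ι : Type*} {C : Set (ι → ℝ)}

theorem convexHull_range_eq_image_stdSimplex [Fintype ι] {E : Type*} [AddCommGroup E] [Module ℝ E]
    (f : ι → E) : convexHull ℝ (Set.range f) = (fun w => ∑ i, w i • f i) '' stdSimplex ℝ ι := by
  classical
  have hbasis : f = Fintype.linearCombination ℝ f ∘ fun i j => if i = j then 1 else 0 := by
    ext i
    simp [Fintype.linearCombination_apply]
  conv_lhs => rw [hbasis]
  rw [Set.range_comp, ← LinearMap.image_convexHull, convexHull_basis_eq_stdSimplex]
  rfl

theorem indicator_const_mem_of_le (hC : Convex ℝ C) (hC₀ : 0 ∈ C) {s : Set ι} {x y : ℝ}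
    (hy : 0 ≤ y) (hyx : y ≤ x) (hx : s.indicator (fun _ => x) ∈ C) :
    s.indicator (fun _ => y) ∈ C := by
  rcases hy.eq_or_lt with rfl | hy
  · rwa [Set.indicator_zero]
  have hx₀ : 0 < x := hy.trans_le hyx
  convert hC.smul_mem_of_zero_mem hC₀ hx ⟨by positivity, div_le_one_of_le₀ hyx hx₀.le⟩ using 1
  ext i
  rw [Pi.smul_apply, ← Set.indicator_const_smul_apply, smul_eq_mul, div_mul_cancel₀ _ hx₀.ne']

theorem sum_indicator_erase_const [DecidableEq ι] (S : Finset ι) (x : ℝ) :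
    ∑ k ∈ S, (S.erase k : Set ι).indicator (fun _ => x) =
      ((S.card : ℝ) - 1) • (S : Set ι).indicator fun _ => x := by
  ext j
  simp only [Finset.sum_apply, Pi.smul_apply, Set.indicator_apply, Finset.mem_coe]
  rw [← Finset.sum_filter, Finset.sum_const]
  split_ifs with hj
  · have hfilter : S.filter (fun k => j ∈ S.erase k) = S.erase j := by
      ext k
      simp only [Finset.mem_filter, Finset.mem_erase]
      tauto
    rw [hfilter, ← Nat.cast_smul_eq_nsmul ℝ, ← Finset.card_erase_add_one hj, Nat.cast_succ,
      add_sub_cancel_right]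
  · rw [Finset.filter_false_of_mem fun k _ hjk => hj (Finset.mem_of_mem_erase hjk),
      Finset.card_empty, zero_smul, smul_zero]

theorem indicator_div_card_mem (hC : Convex ℝ C) {m : ℕ} (hm : 0 < m) {v : ℝ}
    (h : ∀ S : Finset ι, S.card = m → (S : Set ι).indicator (fun _ => v / S.card) ∈ C)
    {S : Finset ι} (hS : m ≤ S.card) : (S : Set ι).indicator (fun _ => v / S.card) ∈ C := by
  classical
  obtain ⟨n, hn⟩ := Nat.exists_eq_add_of_le hS
  clear hS
  induction n generalizing S with
  | zero => exact h S hn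
  | succ n ih =>
    have hmn : (0 : ℝ) < (m + n : ℕ) := by positivity
    have hSn : (S.card : ℝ) = (m + n : ℕ) + 1 := by rw [hn]; push_cast; ring
    have herase (k : ι) (hk : k ∈ S) : (S.erase k).card = m + n := by
      rw [Finset.card_erase_of_mem hk, hn]; omega
    have hmem : ∑ k ∈ S, (S.card : ℝ)⁻¹ •
        (S.erase k : Set ι).indicator (fun _ => v / (m + n : ℕ)) ∈ C := by
      refine hC.sum_mem (fun _ _ => by positivity) ?_ fun k hk => herase k hk ▸ ih (herase k hk)
      rw [Finset.sum_const, nsmul_eq_mul, mul_inv_cancel₀]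
      rw [hSn]
      positivity
    rw [← Finset.smul_sum, sum_indicator_erase_const, hSn, add_sub_cancel_right] at hmem
    convert hmem using 1
    ext j
    simp only [Pi.smul_apply, smul_eq_mul, Set.indicator_apply]
    split_ifs
    · rw [mul_div_cancel₀ _ hmn.ne', hSn, inv_mul_eq_div]
    · rw [mul_zero, mul_zero]

variable [DecidableEq ι]

theorem update_zero_mem_convexHull {s : Set (ι → ℝ)} {k : ι}
    (hs : ∀ x ∈ s, Function.update x k 0 ∈ convexHull ℝ s) {x : ι → ℝ}
    (hx : x ∈ convexHull ℝ s) : Function.update x k 0 ∈ convexHull ℝ s := by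
  refine convexHull_min (t := {x | Function.update x k 0 ∈ convexHull ℝ s}) hs ?_ hx
  intro x hx y hy a b ha hb hab
  have hxy := convex_convexHull ℝ s hx hy ha hb hab
  rwa [← Function.update_smul, ← Function.update_smul, ← Function.update_add, smul_zero,
    smul_zero, add_zero] at hxy

theorem update_mem_of_le (hC : Convex ℝ C) {x : ι → ℝ} (hx : x ∈ C) {k : ι}
    (hk : Function.update x k 0 ∈ C) {y : ℝ} (hy : 0 ≤ y) (hyx : y ≤ x k) :
    Function.update x k y ∈ C := by
  have hseg : y ∈ segment ℝ 0 (x k) := (segment_eq_Icc (hy.trans hyx)).symm ▸ ⟨hy, hyx⟩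
  have himage := Set.mem_image_of_mem (Function.update x k) hseg
  rw [Pi.image_update_segment, Function.update_eq_self] at himage
  exact hC.segment_subset hk hx himage

theorem mem_of_nonneg_of_le [Finite ι] (hC : Convex ℝ C)
    (hC₀ : ∀ k, ∀ x ∈ C, Function.update x k 0 ∈ C) {x y : ι → ℝ} (hx : x ∈ C) (hy : 0 ≤ y)
    (hyx : y ≤ x) : y ∈ C := by
  have := Fintype.ofFinite ι
  rw [← Finset.piecewise_univ y x]
  generalize (Finset.univ : Finset ι) = T
  induction T using Finset.induction_on with
  | empty => rwa [Finset.piecewise_empty]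
  | insert k T hk ih =>
    rw [Finset.piecewise_insert]
    refine update_mem_of_le hC ih (hC₀ k _ ih) (hy k) ?_
    rw [Finset.piecewise_eq_of_notMem _ _ _ hk]
    exact hyx k

end Geometry

namespace Params

variable (p : Params)

theorem r_pos {L : ℕ} (hL₀ : 0 < L) (hL : L ≤ p.N) : 0 < p.r L := by
  obtain ⟨M, rfl⟩ := Nat.exists_eq_add_one.2 hL₀
  have hd : (0 : ℝ) < p.d := Nat.cast_pos.2 p.d_pos
  have hθ := p.one_sub_mul_θ_pos hL
  have hR := p.R_pos
  have hF := p.F_pos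
  rw [r_succ]
  positivity

theorem r_succ_le {L : ℕ} (hL₀ : 0 < L) (hL : L ≤ p.N) : p.r (L + 1) ≤ p.r L := by
  obtain ⟨M, rfl⟩ := Nat.exists_eq_add_one.2 hL₀
  have hθ := p.one_sub_mul_θ_pos hL
  have hR := p.R_pos
  have hF := p.F_pos
  have hθ' := p.θ_pos
  rw [r_succ, r_succ]
  have hpow := pow_le_pow_of_le_one hF.le p.F_le_one M.le_succ
  gcongr
  · simp

theorem ratePoint_eq_indicator (S : Finset (Fin p.N)) :
    p.ratePoint S = (S : Set (Fin p.N)).indicator fun _ => p.r S.card := by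
  ext k
  simp [ratePoint, Set.indicator_apply]

theorem ratePoint_empty : p.ratePoint ∅ = 0 := by
  rw [ratePoint_eq_indicator, Finset.coe_empty, Set.indicator_empty]
  rfl

theorem ratePoint_nonneg (S : Finset (Fin p.N)) : 0 ≤ p.ratePoint S := fun k => by
  rw [ratePoint]
  split_ifs with hk
  · exact (p.r_pos (Finset.card_pos.2 ⟨k, hk⟩) (p.card_le S)).le
  · exact le_rfl

/-- The average rates attainable by time sharing between arbitrary sets of active pairs. -/
noncomputable def rateRegion : Set (Fin p.N → ℝ) := convexHull ℝ (Set.range p.ratePoint)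

theorem convex_rateRegion : Convex ℝ p.rateRegion := convex_convexHull ℝ _

theorem isClosed_rateRegion : IsClosed p.rateRegion :=
  ((Set.finite_range _).isCompact_convexHull ℝ).isClosed

theorem ratePoint_mem_rateRegion (S : Finset (Fin p.N)) : p.ratePoint S ∈ p.rateRegion :=
  subset_convexHull ℝ _ ⟨S, rfl⟩

theorem zero_mem_rateRegion : 0 ∈ p.rateRegion :=
  p.ratePoint_empty ▸ p.ratePoint_mem_rateRegion ∅

theorem rateRegion_subset_Ici : p.rateRegion ⊆ Set.Ici 0 :=
  convexHull_min (Set.range_subset_iff.2 p.ratePoint_nonneg) (convex_Ici 0)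

theorem update_zero_ratePoint_mem (S : Finset (Fin p.N)) (k : Fin p.N) :
    Function.update (p.ratePoint S) k 0 ∈ p.rateRegion := by
  by_cases hk : k ∈ S
  · have hupdate : Function.update (p.ratePoint S) k 0 =
        (S.erase k : Set (Fin p.N)).indicator fun _ => p.r S.card := by
      ext j
      rcases eq_or_ne j k with rfl | hj <;>
        simp [ratePoint, Set.indicator_apply, *]
    have hcard := Finset.card_erase_add_one hk
    rcases (S.erase k).eq_empty_or_nonempty with hempty | hne
    · rw [hupdate, hempty, Finset.coe_empty, Set.indicator_empty]
      exact p.zero_mem_rateRegion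
    · rw [hupdate]
      refine indicator_const_mem_of_le p.convex_rateRegion p.zero_mem_rateRegion
        (p.r_pos (Finset.card_pos.2 ⟨k, hk⟩) (p.card_le S)).le
        (hcard ▸ p.r_succ_le hne.card_pos (p.card_le _)) ?_
      rw [← ratePoint_eq_indicator]
      exact p.ratePoint_mem_rateRegion _
  · rw [Function.update_eq_self_iff.2 (if_neg hk).symm]
    exact p.ratePoint_mem_rateRegion S

theorem mem_rateRegion_of_le {x y : Fin p.N → ℝ} (hx : x ∈ p.rateRegion) (hy : 0 ≤ y)
    (hyx : y ≤ x) : y ∈ p.rateRegion := by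
  refine mem_of_nonneg_of_le p.convex_rateRegion (fun k x hx => ?_) hx hy hyx
  refine update_zero_mem_convexHull ?_ hx
  rintro _ ⟨S, rfl⟩
  exact p.update_zero_ratePoint_mem S k

theorem exists_const_mem_rateRegion : ∃ η > 0, (fun _ => η) ∈ p.rateRegion := by
  refine ⟨p.r p.N, p.r_pos p.N_pos le_rfl, ?_⟩
  have hmem := p.ratePoint_mem_rateRegion Finset.univ
  rwa [ratePoint_eq_indicator, Finset.coe_univ, Set.indicator_univ, Finset.card_fin] at hmem

theorem rateHull_eq (M : ℕ) : p.rateHull M = convexHull ℝ (p.ratePoint '' {S | S.card ≤ M}) := by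
  rw [rateHull]
  congr 1
  ext x
  simp only [Set.mem_iUnion, Finset.mem_range, Nat.lt_succ_iff, ratePoints, Set.mem_ofPred_eq,
    Set.mem_image, exists_prop]
  constructor
  · rintro ⟨_, hL, S, rfl, rfl⟩
    exact ⟨S, hL, rfl⟩
  · rintro ⟨S, hS, rfl⟩
    exact ⟨S.card, hS, S, rfl, rfl⟩

theorem pos_of_forall_rT_le {LI : ℕ} (hLI : ∀ L ≤ p.N, p.rT L ≤ p.rT LI) : 0 < LI := by
  rw [Nat.pos_iff_ne_zero]
  rintro rfl
  have h₁ := hLI 1 p.N_pos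
  rw [rT, rT, Nat.cast_one, one_mul, Nat.cast_zero, zero_mul] at h₁
  exact h₁.not_gt (p.r_pos one_pos p.N_pos)

theorem ratePoint_mem_rateHull {LI : ℕ} (hLI : ∀ L ≤ p.N, p.rT L ≤ p.rT LI)
    (S : Finset (Fin p.N)) : p.ratePoint S ∈ p.rateHull LI := by
  have hpos := p.pos_of_forall_rT_le hLI
  have hmem (T : Finset (Fin p.N)) (hT : T.card ≤ LI) : p.ratePoint T ∈ p.rateHull LI :=
    p.rateHull_eq LI ▸ subset_convexHull ℝ _ ⟨T, hT, rfl⟩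
  rcases le_total S.card LI with hS | hS
  · exact hmem S hS
  have hS₀ : (0 : ℝ) < S.card := Nat.cast_pos.2 (hpos.trans_le hS)
  rw [ratePoint_eq_indicator]
  refine indicator_const_mem_of_le (x := p.rT LI / S.card) (convex_convexHull ℝ _)
    (p.ratePoint_empty ▸ hmem ∅ (by simp))
    (p.r_pos (hpos.trans_le hS) (p.card_le S)).le ?_
    (indicator_div_card_mem (convex_convexHull ℝ _) hpos (fun T hT => ?_) hS)
  · rw [le_div_iff₀ hS₀, mul_comm]
    exact hLI S.card (p.card_le S)
  · rw [hT, rT, mul_div_cancel_left₀ _ (Nat.cast_pos.2 hpos).ne']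
    have := hmem T hT.le
    rwa [ratePoint_eq_indicator, hT] at this

theorem rateHull_eq_rateRegion {LI : ℕ} (hLI : ∀ L ≤ p.N, p.rT L ≤ p.rT LI) :
    p.rateHull LI = p.rateRegion := by
  refine Set.Subset.antisymm ?_ (convexHull_min
    (Set.range_subset_iff.2 (p.ratePoint_mem_rateHull hLI)) (convex_convexHull ℝ _))
  rw [rateHull_eq]
  exact convexHull_mono (Set.image_subset_range _ _)

end Params

/-! ### Independence -/

section Independence

variable {Ω α β γ : Type*} [MeasurableSpace Ω] [MeasurableSpace α] [MeasurableSpace β]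
  [MeasurableSpace γ] {μ : Measure Ω}

theorem indepFun_past_present {X : ℕ → Type*} [∀ i, MeasurableSpace (X i)]
    (μ : (i : ℕ) → Measure (X i)) [∀ i, IsProbabilityMeasure (μ i)] (t : ℕ) :
    IndepFun (fun ω (i : Fin t) => ω i) (fun ω => ω t) (Measure.infinitePi μ) := by
  have hind : iIndepFun (fun i (ω : (i : ℕ) → X i) => ω i) (Measure.infinitePi μ) :=
    iIndepFun_infinitePi (X := fun _ x => x) fun _ => measurable_id
  have hpresent : Measurable fun x : (i : ({t} : Finset ℕ)) → X i =>
      x ⟨t, Finset.mem_singleton_self t⟩ :=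
    measurable_pi_apply (X := fun i : ({t} : Finset ℕ) => X i) ⟨t, Finset.mem_singleton_self t⟩
  exact (hind.indepFun_finset (Finset.range t) {t} (by simp) measurable_pi_apply).comp
    (φ := fun x (i : Fin t) => x ⟨i, Finset.mem_range.2 i.2⟩) (by fun_prop) hpresent

theorem indepFun_prodMk_left [IsProbabilityMeasure μ] {X : Ω → α} {Y : Ω → β} {Z : Ω → γ}
    (hX : Measurable X) (hY : Measurable Y) (hZ : Measurable Z)
    (hXYZ : IndepFun X (fun ω => (Y ω, Z ω)) μ) (hYZ : IndepFun Y Z μ) :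
    IndepFun (fun ω => (X ω, Y ω)) Z μ := by
  have hXY : IndepFun X Y μ := hXYZ.comp measurable_id measurable_fst
  have := Measure.isProbabilityMeasure_map (μ := μ) hX.aemeasurable
  have := Measure.isProbabilityMeasure_map (μ := μ) hY.aemeasurable
  have := Measure.isProbabilityMeasure_map (μ := μ) hZ.aemeasurable
  rw [indepFun_iff_map_prod_eq_prod_map_map (by fun_prop) (by fun_prop)] at hXY hYZ hXYZ ⊢
  rw [hXY, ← (measurePreserving_prodAssoc _ _ _).symm.map_eq, ← hYZ, ← hXYZ,
    Measure.map_map (by fun_prop) (by fun_prop)]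
  rfl

theorem lintegral_comp_of_indepFun {ι : Type*} [Fintype ι] {X : Ω → α} {Y : Ω → β}
    (hX : Measurable X) (hY : Measurable Y) (hXY : IndepFun X Y μ) {S : α → ι}
    (hS : ∀ i, MeasurableSet {x | S x = i}) {g : ι → β → ℝ≥0∞} (hg : ∀ i, Measurable (g i)) :
    ∫⁻ ω, g (S (X ω)) (Y ω) ∂μ = ∑ i, μ {ω | S (X ω) = i} * ∫⁻ ω, g i (Y ω) ∂μ := by
  classical
  have hind (i : ι) : Measurable ({x | S x = i}.indicator (1 : α → ℝ≥0∞)) :=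
    measurable_one.indicator (hS i)
  have hsplit (ω : Ω) : g (S (X ω)) (Y ω) =
      ∑ i, {x | S x = i}.indicator 1 (X ω) * g i (Y ω) := by
    simp [Set.indicator_apply]
  simp_rw [hsplit]
  rw [lintegral_finsetSum Finset.univ (f := fun i ω =>
    {x | S x = i}.indicator 1 (X ω) * g i (Y ω)) fun i _ => ((hind i).comp hX).mul ((hg i).comp hY)]
  refine Finset.sum_congr rfl fun i _ => ?_
  have hSX : MeasurableSet {ω | S (X ω) = i} := hX (hS i)
  rw [← lintegral_indicator_one hSX]
  exact lintegral_mul_eq_lintegral_mul_lintegral_of_indepFun ((hind i).comp hX) ((hg i).comp hY)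
    (hXY.comp (hind i) (hg i))

end Independence

/-! ### Queue dynamics -/

section Dynamics

variable {p : Params} {H : Type*} [MeasurableSpace H] (c : Fading p H)

theorem Fading.measurable_service_comp {α : Type*} [MeasurableSpace α]
    {S : α → Finset (Fin p.N)} {h : α → H} (hS : ∀ T, MeasurableSet {a | S a = T})
    (hh : Measurable h) (k : Fin p.N) : Measurable fun a => c.service (S a) (h a) k := by
  have hsplit : (fun a => c.service (S a) (h a) k) =
      fun a => ∑ T, if S a = T then c.service T (h a) k else 0 := by
    ext a
    rw [Finset.sum_ite_eq, if_pos (Finset.mem_univ _)]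
  rw [hsplit]
  exact Finset.measurable_sum _ fun T _ =>
    ((c.measurable_service T k).comp hh).ite (hS T) measurable_const

theorem measurable_step {α : Type*} [MeasurableSpace α] {q : α → Fin p.N → ℝ}
    {S : α → Finset (Fin p.N)} {x : α → Slot p H} (hq : Measurable q)
    (hS : ∀ T, MeasurableSet {a | S a = T}) (hx : Measurable x) :
    Measurable fun a => step c (q a) (S a) (x a) := by
  have hservice := c.measurable_service_comp hS hx.snd.fst
  unfold step
  fun_prop

namespace CausalPolicy

variable (π : CausalPolicy p H)

/-- The number of bits served for user `k` in slot `t`. -/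
noncomputable def served (t : ℕ) (ω : ℕ → Slot p H) (k : Fin p.N) : ℝ :=
  c.service (π.choose t (fun i => ω i) (ω t).2.2) (ω t).2.1 k

theorem measurableSet_choose_eq (t : ℕ) (T : Finset (Fin p.N)) :
    MeasurableSet {ω : ℕ → Slot p H | π.choose t (fun i => ω i) (ω t).2.2 = T} :=
  (show Measurable fun ω : ℕ → Slot p H => ((fun i : Fin t => ω i), (ω t).2.2) by fun_prop)
    (π.measurable t T)

theorem measurable_queue (q0 : Fin p.N → ℝ) (t : ℕ) : Measurable (π.queue c q0 t) := by
  induction t with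
  | zero => exact measurable_const
  | succ t ih => exact measurable_step c ih (π.measurableSet_choose_eq t) (measurable_pi_apply t)

end CausalPolicy

namespace Policy

variable (π : Policy p)

/-- The queue lengths under a centralized policy at time `t`, as a function of the slots
before `t`. -/
noncomputable def pastQueue (q0 : Fin p.N → ℝ) : (t : ℕ) → (Fin t → Slot p H) → Fin p.N → ℝ
  | 0, _ => q0
  | t + 1, x => step c (pastQueue q0 t fun i => x i.castSucc)
      (π.choose (pastQueue q0 t fun i => x i.castSucc) (x (Fin.last t)).2.2) (x (Fin.last t))

theorem queue_eq_pastQueue (q0 : Fin p.N → ℝ) (t : ℕ) (ω : ℕ → Slot p H) :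
    π.queue c q0 t ω = π.pastQueue c q0 t (fun i => ω i) := by
  induction t with
  | zero => rfl
  | succ t ih => simp only [queue, pastQueue, ih, Fin.val_castSucc, Fin.val_last]

theorem measurable_pastQueue (q0 : Fin p.N → ℝ) (t : ℕ) : Measurable (π.pastQueue c q0 t) := by
  induction t with
  | zero => exact measurable_const
  | succ t ih =>
    have hpast : Measurable fun x : Fin (t + 1) → Slot p H =>
        π.pastQueue c q0 t fun i => x i.castSucc := ih.comp (by fun_prop)
    have hlast : Measurable fun x : Fin (t + 1) → Slot p H => x (Fin.last t) := by fun_prop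
    exact measurable_step c hpast (fun T => (hpast.prodMk hlast.snd.snd) (π.measurable T)) hlast

theorem measurable_queue (q0 : Fin p.N → ℝ) (t : ℕ) : Measurable (π.queue c q0 t) := by
  rw [funext (π.queue_eq_pastQueue c q0 t)]
  exact (π.measurable_pastQueue c q0 t).comp (by fun_prop)

/-- A centralized policy, started from the queue lengths `q0`, as a causal policy: the current
queue lengths are computed from the slots before the current one. -/
noncomputable def toCausal (q0 : Fin p.N → ℝ) : CausalPolicy p H where
  choose t x u := π.choose (π.pastQueue c q0 t x) u
  measurable t S :=
    (((π.measurable_pastQueue c q0 t).comp measurable_fst).prodMk measurable_snd) (π.measurable S)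

theorem queue_toCausal (q0 : Fin p.N → ℝ) : (π.toCausal c q0).queue c q0 = π.queue c q0 := by
  ext t ω : 2
  induction t with
  | zero => rfl
  | succ t ih =>
    simp only [queue, CausalPolicy.queue, ih]
    simp only [toCausal, π.queue_eq_pastQueue c q0 t ω]

end Policy

end Dynamics

/-! ### Expected arrivals and service -/

section Means

theorem Arrivals.mean_nonneg {N : ℕ} (A : Arrivals N) : 0 ≤ A.mean := fun k => by
  obtain ⟨M, hM⟩ := A.bounded
  exact integral_nonneg_of_ae ((hM k).mono fun x hx => hx.1)

theorem Arrivals.lintegral_ofReal {N : ℕ} (A : Arrivals N) (k : Fin N) :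
    ∫⁻ x, ENNReal.ofReal x ∂A.law k = ENNReal.ofReal (A.mean k) := by
  obtain ⟨M, hM⟩ := A.bounded
  have := A.isProb k
  refine (ofReal_integral_eq_lintegral_ofReal ?_ ((hM k).mono fun x hx => hx.1)).symm
  refine Integrable.of_bound (C := M) (by fun_prop) ((hM k).mono fun x hx => ?_)
  rw [Real.norm_of_nonneg hx.1]
  exact hx.2.le

variable {p : Params} {H : Type*} [MeasurableSpace H] (c : Fading p H) (A : Arrivals p.N)

instance : IsProbabilityMeasure (pathLaw c A) := by
  unfold pathLaw
  infer_instance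

theorem measurePreserving_slot (t : ℕ) :
    MeasurePreserving (fun ω : ℕ → Slot p H => ω t) (pathLaw c A) (slotLaw c A) :=
  measurePreserving_eval_infinitePi _ t

theorem measurePreserving_fading (t : ℕ) :
    MeasurePreserving (fun ω : ℕ → Slot p H => (ω t).2.1) (pathLaw c A) c.law := by
  have := c.isProb
  have := A.isProb
  exact (measurePreserving_fst.comp measurePreserving_snd).comp (measurePreserving_slot c A t)

theorem measurePreserving_coin (t : ℕ) :
    MeasurePreserving (fun ω : ℕ → Slot p H => (ω t).2.2) (pathLaw c A) volume := by
  have := c.isProb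
  have := A.isProb
  exact (measurePreserving_snd.comp measurePreserving_snd).comp (measurePreserving_slot c A t)

theorem measurePreserving_arrival (t : ℕ) (k : Fin p.N) :
    MeasurePreserving (fun ω : ℕ → Slot p H => (ω t).1 k) (pathLaw c A) (A.law k) := by
  have := c.isProb
  have := A.isProb
  exact ((measurePreserving_eval A.law k).comp measurePreserving_fst).comp
    (measurePreserving_slot c A t)

theorem exists_ae_arrival_le : ∃ M : ℝ, ∀ t k,
    ∀ᵐ ω ∂pathLaw c A, 0 ≤ (ω t).1 k ∧ (ω t).1 k ≤ M := by
  obtain ⟨M, hM⟩ := A.bounded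
  refine ⟨M, fun t k => ?_⟩
  filter_upwards [(measurePreserving_arrival c A t k).quasiMeasurePreserving.ae (hM k)] with ω hω
  exact ⟨hω.1, hω.2.le⟩

theorem lintegral_arrival (t : ℕ) (k : Fin p.N) :
    ∫⁻ ω, ENNReal.ofReal ((ω t).1 k) ∂pathLaw c A = ENNReal.ofReal (A.mean k) := by
  rw [(measurePreserving_arrival c A t k).lintegral_comp ENNReal.measurable_ofReal,
    A.lintegral_ofReal]

theorem indepFun_past_slot (t : ℕ) :
    IndepFun (fun (ω : ℕ → Slot p H) (i : Fin t) => ω i) (fun ω => ω t) (pathLaw c A) :=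
  indepFun_past_present _ t

theorem indepFun_coin_fading (t : ℕ) :
    IndepFun (fun ω : ℕ → Slot p H => (ω t).2.2) (fun ω => (ω t).2.1) (pathLaw c A) := by
  have := c.isProb
  have := A.isProb
  have hprod : MeasurePreserving (fun ω : ℕ → Slot p H => (ω t).2) (pathLaw c A)
    (c.law.prod volume) := measurePreserving_snd.comp (measurePreserving_slot c A t)
  refine IndepFun.symm ?_
  rw [indepFun_iff_map_prod_eq_prod_map_map
    (measurePreserving_fading c A t).aemeasurable (measurePreserving_coin c A t).aemeasurable,
    (measurePreserving_fading c A t).map_eq, (measurePreserving_coin c A t).map_eq]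
  exact hprod.map_eq

theorem indepFun_past_coin_fading (t : ℕ) :
    IndepFun (fun ω : ℕ → Slot p H => ((fun i : Fin t => ω i), (ω t).2.2))
      (fun ω => (ω t).2.1) (pathLaw c A) :=
  indepFun_prodMk_left (by fun_prop) (by fun_prop) (by fun_prop)
    ((indepFun_past_slot c A t).comp measurable_id
      (ψ := fun y : Slot p H => (y.2.2, y.2.1)) (by fun_prop))
    (indepFun_coin_fading c A t)

namespace CausalPolicy

variable (π : CausalPolicy p H)

theorem lintegral_served (t : ℕ) (k : Fin p.N) :
    ∫⁻ ω, ENNReal.ofReal (π.served c t ω k) ∂pathLaw c A =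
      ∑ T, pathLaw c A {ω | π.choose t (fun i => ω i) (ω t).2.2 = T} *
        ENNReal.ofReal (p.ratePoint T k) := by
  have hg (T : Finset (Fin p.N)) : Measurable fun h => ENNReal.ofReal (c.service T h k) :=
    (c.measurable_service T k).ennreal_ofReal
  refine (lintegral_comp_of_indepFun (by fun_prop) (by fun_prop)
    (indepFun_past_coin_fading c A t) (π.measurable t) hg).trans ?_
  simp only [fun T => (measurePreserving_fading c A t).lintegral_comp (hg T), c.lintegral_service]

theorem exists_mem_rateRegion_lintegral_served (t : ℕ) :
    ∃ b ∈ p.rateRegion, ∀ k,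
      ∫⁻ ω, ENNReal.ofReal (π.served c t ω k) ∂pathLaw c A = ENNReal.ofReal (b k) := by
  let w (T : Finset (Fin p.N)) : ℝ :=
    (pathLaw c A).real {ω | π.choose t (fun i => ω i) (ω t).2.2 = T}
  have hw : ∑ T, w T = 1 :=
    (sum_measureReal_preimage_singleton Finset.univ
      fun T _ => π.measurableSet_choose_eq t T).trans (by simp)
  refine ⟨∑ T, w T • p.ratePoint T, p.convex_rateRegion.sum_mem
    (fun T _ => measureReal_nonneg) hw fun T _ => p.ratePoint_mem_rateRegion T, fun k => ?_⟩
  have hnonneg (T : Finset (Fin p.N)) : 0 ≤ (w T • p.ratePoint T) k :=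
    mul_nonneg measureReal_nonneg (p.ratePoint_nonneg T k)
  rw [π.lintegral_served, Finset.sum_apply, ENNReal.ofReal_sum_of_nonneg fun T _ => hnonneg T]
  refine Finset.sum_congr rfl fun T _ => ?_
  rw [Pi.smul_apply, smul_eq_mul, ENNReal.ofReal_mul measureReal_nonneg, ofReal_measureReal]

end CausalPolicy

end Means

/-! ### Necessity -/

section Cesaro

theorem limsup_sum_lt_top {α ι : Type*} [Fintype ι] {l : Filter α} {u : ι → α → ℝ≥0∞}
    (hu : ∀ i, limsup (u i) l < ⊤) : limsup (fun n => ∑ i, u i n) l < ⊤ := by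
  choose C huC hC using fun i => exists_between (hu i)
  refine lt_of_le_of_lt (b := ∑ i, C i) (limsup_le_of_le (h := ?_))
    (ENNReal.sum_lt_top.2 fun i _ => hC i)
  filter_upwards [eventually_all.2 fun i => eventually_lt_of_limsup_lt (huC i)] with n hn
  exact Finset.sum_le_sum fun i _ => (hn i).le

theorem ofReal_mul_choose_two_le_sum {f : ℕ → ℝ≥0∞} {η : ℝ}
    (hf : ∀ t : ℕ, ENNReal.ofReal (η * t) ≤ f t) (T : ℕ) :
    ENNReal.ofReal (η * (T * (T - 1) / 2)) ≤ ∑ t ∈ Finset.range T, f t := by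
  induction T with
  | zero => simp
  | succ T ih =>
    calc ENNReal.ofReal (η * (((T + 1 : ℕ) : ℝ) * ((T + 1 : ℕ) - 1) / 2))
        = ENNReal.ofReal (η * (T * (T - 1) / 2) + η * T) := by push_cast; congr 1; ring
      _ ≤ ENNReal.ofReal (η * (T * (T - 1) / 2)) + ENNReal.ofReal (η * T) :=
        ENNReal.ofReal_add_le
      _ ≤ ∑ t ∈ Finset.range (T + 1), f t := by
        rw [Finset.sum_range_succ]
        exact add_le_add ih (hf T)

theorem exists_le_ofReal_mul_of_limsup_lt_top {f : ℕ → ℝ≥0∞}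
    (hf : limsup (fun T : ℕ => (∑ t ∈ Finset.range T, f t) / (T : ℝ≥0∞)) atTop < ⊤) {η : ℝ}
    (hη : 0 < η) : ∃ T : ℕ, 0 < T ∧ f T ≤ ENNReal.ofReal (η * T) := by
  by_contra! hcon
  have hlin (t : ℕ) : ENNReal.ofReal (η * t) ≤ f t := by
    rcases t.eq_zero_or_pos with rfl | ht
    · simp
    · exact (hcon t ht).le
  have hmean (T : ℕ) : ENNReal.ofReal (η / 2 * (T - 1)) ≤
      (∑ t ∈ Finset.range T, f t) / (T : ℝ≥0∞) := by
    rcases T.eq_zero_or_pos with rfl | hT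
    · rw [ENNReal.ofReal_of_nonpos (by push_cast; linarith)]
      exact zero_le
    rw [ENNReal.le_div_iff_mul_le (Or.inl (Nat.cast_ne_zero.2 hT.ne'))
      (Or.inl (ENNReal.natCast_ne_top T))]
    refine le_trans ?_ (ofReal_mul_choose_two_le_sum hlin T)
    rw [← ENNReal.ofReal_natCast, ← ENNReal.ofReal_mul' T.cast_nonneg]
    exact ENNReal.ofReal_le_ofReal (by linarith)
  have htop : Tendsto (fun T : ℕ => ENNReal.ofReal (η / 2 * (T - 1))) atTop (𝓝 ⊤) :=
    ENNReal.tendsto_ofReal_atTop.comp ((tendsto_atTop_add_const_right _ _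
      tendsto_natCast_atTop_atTop).const_mul_atTop (half_pos hη))
  exact hf.ne (tendsto_nhds_top_mono' htop hmean).limsup_eq

theorem StronglyStable.exists_lintegral_le {Ω : Type*} [MeasurableSpace Ω] {μ : Measure Ω} {N : ℕ}
    {q : ℕ → Ω → Fin N → ℝ} (hq : StronglyStable μ q) {η : ℝ} (hη : 0 < η) :
    ∃ T : ℕ, 0 < T ∧ ∀ k, ∫⁻ ω, ENNReal.ofReal (q T ω k) ∂μ ≤ ENNReal.ofReal (η * T) := by
  have hsum := limsup_sum_lt_top hq
  simp only [ENNReal.div_eq_inv_mul, ← Finset.mul_sum] at hsum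
  simp only [← ENNReal.div_eq_inv_mul] at hsum
  simp_rw [Finset.sum_comm (s := Finset.univ)] at hsum
  obtain ⟨T, hT, hle⟩ := exists_le_ofReal_mul_of_limsup_lt_top hsum hη
  exact ⟨T, hT, fun k => (Finset.single_le_sum
    (f := fun k => ∫⁻ ω, ENNReal.ofReal (q T ω k) ∂μ) (fun _ _ => zero_le)
    (Finset.mem_univ k)).trans hle⟩

end Cesaro

section Converse

theorem add_sum_le_add_sum {M : Type*} [AddCommMonoid M] [PartialOrder M] [IsOrderedAddMonoid M]
    {f a b : ℕ → M} (h : ∀ t, f t + a t ≤ f (t + 1) + b t) (T : ℕ) :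
    f 0 + ∑ t ∈ Finset.range T, a t ≤ f T + ∑ t ∈ Finset.range T, b t := by
  induction T with
  | zero => simp
  | succ T ih =>
    rw [Finset.sum_range_succ, Finset.sum_range_succ, ← add_assoc, ← add_assoc]
    calc f 0 + ∑ t ∈ Finset.range T, a t + a T
        ≤ f T + ∑ t ∈ Finset.range T, b t + a T := by gcongr
      _ = f T + a T + ∑ t ∈ Finset.range T, b t := add_right_comm _ _ _
      _ ≤ f (T + 1) + b T + ∑ t ∈ Finset.range T, b t := add_le_add_left (h T) _
      _ = f (T + 1) + ∑ t ∈ Finset.range T, b t + b T := add_right_comm _ _ _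

theorem ofReal_add_le_ofReal_max_sub_add {q a b : ℝ} (ha : 0 ≤ a) (hb : 0 ≤ b) :
    ENNReal.ofReal q + ENNReal.ofReal a ≤
      ENNReal.ofReal (max (q - b) 0 + a) + ENNReal.ofReal b := by
  have hmax : max q 0 + a ≤ max (q - b) 0 + a + b := by
    rcases max_cases q 0 with h | h <;> rcases max_cases (q - b) 0 with h' | h' <;> linarith
  calc ENNReal.ofReal q + ENNReal.ofReal a
      ≤ ENNReal.ofReal (max q 0) + ENNReal.ofReal a := by gcongr; exact le_max_left _ _
    _ = ENNReal.ofReal (max q 0 + a) := (ENNReal.ofReal_add (le_max_right _ _) ha).symm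
    _ ≤ ENNReal.ofReal (max (q - b) 0 + a + b) := ENNReal.ofReal_le_ofReal hmax
    _ = _ := ENNReal.ofReal_add (add_nonneg (le_max_right _ _) ha) hb

variable {p : Params} {H : Type*} [MeasurableSpace H] (c : Fading p H) (A : Arrivals p.N)

namespace CausalPolicy

variable (π : CausalPolicy p H) (q0 : Fin p.N → ℝ)

theorem lintegral_queue_add_mean_le (t : ℕ) (k : Fin p.N) :
    ∫⁻ ω, ENNReal.ofReal (π.queue c q0 t ω k) ∂pathLaw c A + ENNReal.ofReal (A.mean k) ≤
      ∫⁻ ω, ENNReal.ofReal (π.queue c q0 (t + 1) ω k) ∂pathLaw c A +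
        ∫⁻ ω, ENNReal.ofReal (π.served c t ω k) ∂pathLaw c A := by
  have hqueue (t : ℕ) : Measurable fun ω => ENNReal.ofReal (π.queue c q0 t ω k) :=
    ((measurable_pi_apply k).comp (π.measurable_queue c q0 t)).ennreal_ofReal
  rw [← lintegral_arrival c A t, ← lintegral_add_left (hqueue t),
    ← lintegral_add_left (hqueue (t + 1))]
  obtain ⟨M, hM⟩ := exists_ae_arrival_le c A
  refine lintegral_mono_ae ?_
  filter_upwards [hM t k] with ω hω
  exact ofReal_add_le_ofReal_max_sub_add hω.1 (c.service_nonneg _ _ k)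

theorem exists_mem_rateRegion_mul_mean_le {T : ℕ} (hT : 0 < T) :
    ∃ b ∈ p.rateRegion, ∀ k, ENNReal.ofReal (T * A.mean k) ≤
      ∫⁻ ω, ENNReal.ofReal (π.queue c q0 T ω k) ∂pathLaw c A + ENNReal.ofReal (T * b k) := by
  choose b hb hserved using π.exists_mem_rateRegion_lintegral_served c A
  have hT₀ : (T : ℝ) ≠ 0 := Nat.cast_ne_zero.2 hT.ne'
  refine ⟨∑ t ∈ Finset.range T, (T : ℝ)⁻¹ • b t, p.convex_rateRegion.sum_mem
    (fun _ _ => by positivity) (by simp [hT₀]) fun t _ => hb t, fun k => ?_⟩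
  have hsum : T * (∑ t ∈ Finset.range T, (T : ℝ)⁻¹ • b t) k = ∑ t ∈ Finset.range T, b t k := by
    rw [← Finset.smul_sum, Pi.smul_apply, smul_eq_mul, mul_inv_cancel_left₀ hT₀, Finset.sum_apply]
  have hstep := add_sum_le_add_sum (fun t => π.lintegral_queue_add_mean_le c A q0 t k) T
  simp only [hserved] at hstep
  rw [← ENNReal.ofReal_sum_of_nonneg fun t _ => p.rateRegion_subset_Ici (hb t) k,
    ← ENNReal.ofReal_sum_of_nonneg fun t _ => A.mean_nonneg k, Finset.sum_const,
    Finset.card_range, nsmul_eq_mul] at hstep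
  rw [hsum]
  exact le_add_self.trans hstep

theorem mean_mem_rateRegion (hπ : StronglyStable (pathLaw c A) (π.queue c q0)) :
    A.mean ∈ p.rateRegion := by
  have hmem (η : ℝ) (hη : 0 < η) : (fun k => max (A.mean k - η) 0) ∈ p.rateRegion := by
    obtain ⟨T, hT, hqueue⟩ := hπ.exists_lintegral_le hη
    obtain ⟨b, hb, hle⟩ := π.exists_mem_rateRegion_mul_mean_le c A q0 hT
    have hT₀ : (0 : ℝ) < T := Nat.cast_pos.2 hT
    refine p.mem_rateRegion_of_le hb (fun k => le_max_right _ _) fun k => ?_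
    have hbk : 0 ≤ b k := p.rateRegion_subset_Ici hb k
    have hle' : T * A.mean k ≤ η * T + T * b k := by
      rw [← ENNReal.ofReal_le_ofReal_iff (by positivity),
        ENNReal.ofReal_add (by positivity) (by positivity)]
      exact (hle k).trans (add_le_add_left (hqueue k) _)
    refine max_le (le_of_mul_le_mul_left ?_ hT₀) hbk
    linarith
  have hcont : Continuous fun (η : ℝ) k => max (A.mean k - η) 0 := by fun_prop
  have hlim : Tendsto (fun (η : ℝ) k => max (A.mean k - η) 0) (𝓝[>] 0) (𝓝 A.mean) := by
    refine (hcont.tendsto' 0 _ ?_).mono_left nhdsWithin_le_nhds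
    ext k
    rw [sub_zero, max_eq_left (show (0 : ℝ) ≤ A.mean k from A.mean_nonneg k)]
  exact p.isClosed_rateRegion.mem_of_tendsto hlim (eventually_nhdsWithin_of_forall hmem)

end CausalPolicy

end Converse

/-! ### Sufficiency -/

section Drift

theorem sq_max_sub_add_add_le {q a b : ℝ} (ha : 0 ≤ a) (hb : 0 ≤ b) :
    (max (q - b) 0 + a) ^ 2 + 2 * (max q 0 * b) ≤ q ^ 2 + (a ^ 2 + b ^ 2) + 2 * (max q 0 * a) := by
  rcases max_cases q 0 with ⟨hq, hq₀⟩ | ⟨hq, hq₀⟩ <;>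
    rcases max_cases (q - b) 0 with ⟨hqb, _⟩ | ⟨hqb, _⟩ <;> rw [hq, hqb]
  · nlinarith [mul_nonneg hb ha]
  · nlinarith [mul_nonneg hq₀ ha, sq_nonneg (q - b)]
  · nlinarith
  · nlinarith [sq_nonneg q, sq_nonneg b]

theorem lintegral_sq_max_sub_add_add_le {Ω : Type*} [MeasurableSpace Ω] {μ : Measure Ω}
    [IsProbabilityMeasure μ] {q a b : Ω → ℝ} {M D : ℝ} (hq : Measurable q) (ha : Measurable a)
    (hb : Measurable b) (hqa : IndepFun q a μ) (hqb : IndepFun q b μ)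
    (haM : ∀ᵐ ω ∂μ, 0 ≤ a ω ∧ a ω ≤ M) (hbD : ∀ᵐ ω ∂μ, 0 ≤ b ω ∧ b ω ≤ D) :
    ∫⁻ ω, ENNReal.ofReal ((max (q ω - b ω) 0 + a ω) ^ 2) ∂μ +
        2 * ((∫⁻ ω, ENNReal.ofReal (q ω) ∂μ) * ∫⁻ ω, ENNReal.ofReal (b ω) ∂μ) ≤
      ∫⁻ ω, ENNReal.ofReal (q ω ^ 2) ∂μ + ENNReal.ofReal (M ^ 2 + D ^ 2) +
        2 * ((∫⁻ ω, ENNReal.ofReal (q ω) ∂μ) * ∫⁻ ω, ENNReal.ofReal (a ω) ∂μ) := by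
  have hprod {f : Ω → ℝ} (hf : Measurable f) (hqf : IndepFun q f μ) :
      2 * ((∫⁻ ω, ENNReal.ofReal (q ω) ∂μ) * ∫⁻ ω, ENNReal.ofReal (f ω) ∂μ) =
        ∫⁻ ω, ENNReal.ofReal (2 * (max (q ω) 0 * f ω)) ∂μ := by
    have hind := lintegral_mul_eq_lintegral_mul_lintegral_of_indepFun hq.ennreal_ofReal
      hf.ennreal_ofReal (hqf.comp ENNReal.measurable_ofReal ENNReal.measurable_ofReal)
    simp only [Pi.mul_apply] at hind
    rw [← hind, ← lintegral_const_mul _ (by fun_prop)]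
    refine lintegral_congr fun ω => ?_
    rw [ENNReal.ofReal_mul zero_le_two, ENNReal.ofReal_mul (le_max_right _ _), ENNReal.ofReal_ofNat,
      ENNReal.ofReal_max, ENNReal.ofReal_zero, max_eq_left zero_le]
  have hconst : ENNReal.ofReal (M ^ 2 + D ^ 2) = ∫⁻ _, ENNReal.ofReal (M ^ 2 + D ^ 2) ∂μ := by
    rw [lintegral_const, measure_univ, mul_one]
  rw [hprod hb hqb, hprod ha hqa, hconst, ← lintegral_add_left (by fun_prop),
    ← lintegral_add_left (by fun_prop), ← lintegral_add_left (by fun_prop)]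
  refine lintegral_mono_ae ?_
  filter_upwards [haM, hbD] with ω ⟨ha₀, haM⟩ ⟨hb₀, hbD⟩
  rw [← ENNReal.ofReal_add (by positivity) (by positivity),
    ← ENNReal.ofReal_add (by positivity) (by positivity),
    ← ENNReal.ofReal_add (by positivity) (by positivity)]
  refine ENNReal.ofReal_le_ofReal ((sq_max_sub_add_add_le ha₀ hb₀).trans ?_)
  gcongr

end Drift

section Lyapunov

variable {V E : ℕ → ℝ≥0∞} {a ε K : ℝ≥0∞}

theorem lyapunov_sum_le (ha : a ≠ ⊤) (hK : K ≠ ⊤) (hV₀ : V 0 ≠ ⊤) (hEV : ∀ t, E t ≤ 1 + V t)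
    (hdrift : ∀ t, V (t + 1) + 2 * (E t * (a + ε)) ≤ V t + K + 2 * (E t * a)) (T : ℕ) :
    V T ≠ ⊤ ∧ V T + 2 * ε * ∑ t ∈ Finset.range T, E t ≤ V 0 + T * K := by
  induction T with
  | zero => simpa using hV₀
  | succ T ih =>
    obtain ⟨hV, hle⟩ := ih
    have hE : E T ≠ ⊤ :=
      ne_top_of_le_ne_top (ENNReal.add_ne_top.2 ⟨ENNReal.one_ne_top, hV⟩) (hEV T)
    have hEa : 2 * (E T * a) ≠ ⊤ :=
      ENNReal.mul_ne_top ENNReal.ofNat_ne_top (ENNReal.mul_ne_top hE ha)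
    have hstep : V (T + 1) + 2 * ε * E T ≤ V T + K := by
      refine (ENNReal.add_le_add_iff_right hEa).1 (le_of_eq_of_le ?_ (hdrift T))
      ring
    refine ⟨ne_top_of_le_ne_top (ENNReal.add_ne_top.2 ⟨hV, hK⟩) (le_self_add.trans hstep), ?_⟩
    rw [Finset.sum_range_succ, Nat.cast_succ]
    calc V (T + 1) + 2 * ε * (∑ t ∈ Finset.range T, E t + E T)
        = V (T + 1) + 2 * ε * E T + 2 * ε * ∑ t ∈ Finset.range T, E t := by ring
      _ ≤ V T + K + 2 * ε * ∑ t ∈ Finset.range T, E t := by gcongr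
      _ = V T + 2 * ε * ∑ t ∈ Finset.range T, E t + K := by ring
      _ ≤ V 0 + T * K + K := by gcongr
      _ = V 0 + (T + 1) * K := by ring

theorem limsup_sum_div_lt_top {V₀ κ : ℝ≥0∞} (hV₀ : V₀ ≠ ⊤) (hK : K ≠ ⊤) (hκ₀ : κ ≠ 0) (hκ : κ ≠ ⊤)
    (h : ∀ T : ℕ, κ * ∑ t ∈ Finset.range T, E t ≤ V₀ + T * K) :
    limsup (fun T : ℕ => (∑ t ∈ Finset.range T, E t) / (T : ℝ≥0∞)) atTop < ⊤ := by
  refine lt_of_le_of_lt (limsup_le_of_le (h := ?_))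
    (ENNReal.div_lt_top (ENNReal.add_ne_top.2 ⟨hV₀, hK⟩) hκ₀)
  filter_upwards [eventually_gt_atTop 0] with T hT
  have hT₀ : (T : ℝ≥0∞) ≠ 0 := Nat.cast_ne_zero.2 hT.ne'
  have hT₁ : (1 : ℝ≥0∞) ≤ T := Nat.one_le_cast.2 hT
  rw [ENNReal.div_le_iff hT₀ (ENNReal.natCast_ne_top T), ← ENNReal.mul_div_right_comm,
    ENNReal.le_div_iff_mul_le (Or.inl hκ₀) (Or.inl hκ), mul_comm]
  calc κ * ∑ t ∈ Finset.range T, E t ≤ V₀ + T * K := h T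
    _ ≤ V₀ * T + T * K := by gcongr; exact le_mul_of_one_le_right' hT₁
    _ = (V₀ + K) * T := by ring

theorem limsup_sum_div_lt_top_of_drift (ha : a ≠ ⊤) (hε₀ : ε ≠ 0) (hε : ε ≠ ⊤) (hK : K ≠ ⊤)
    (hV₀ : V 0 ≠ ⊤) (hEV : ∀ t, E t ≤ 1 + V t)
    (hdrift : ∀ t, V (t + 1) + 2 * (E t * (a + ε)) ≤ V t + K + 2 * (E t * a)) :
    limsup (fun T : ℕ => (∑ t ∈ Finset.range T, E t) / (T : ℝ≥0∞)) atTop < ⊤ :=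
  limsup_sum_div_lt_top hV₀ hK (mul_ne_zero two_ne_zero hε₀)
    (ENNReal.mul_ne_top ENNReal.ofNat_ne_top hε)
    fun T => le_add_self.trans (lyapunov_sum_le ha hK hV₀ hEV hdrift T).2

end Lyapunov

section Stationary

theorem exists_map_unitInterval_of_mem_stdSimplex {ι : Type*} [Fintype ι] {w : ι → ℝ}
    (hw : w ∈ stdSimplex ℝ ι) : ∃ f : unitInterval → ι,
      ∀ i, MeasurableSet {u | f u = i} ∧ volume {u | f u = i} = ENNReal.ofReal (w i) := by
  let : MeasurableSpace ι := ⊤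
  have : DiscreteMeasurableSpace ι := ⟨fun _ => trivial⟩
  have hsum : ∑ i, ENNReal.ofReal (w i) = 1 := by
    rw [← ENNReal.ofReal_sum_of_nonneg fun i _ => hw.1 i, hw.2, ENNReal.ofReal_one]
  let ν : Measure ι := (PMF.ofFintype (fun i => ENNReal.ofReal (w i)) hsum).toMeasure
  have : Nonempty ι := nonempty_of_isProbabilityMeasure ν
  obtain ⟨f, hf, hfν⟩ := ν.exists_measurable_map_eq
  refine ⟨f, fun i => ⟨hf (measurableSet_singleton i), ?_⟩⟩
  have hi : volume.map f {i} = ENNReal.ofReal (w i) := by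
    rw [hfν, PMF.toMeasure_apply_singleton _ _ (measurableSet_singleton i), PMF.ofFintype_apply]
  rwa [Measure.map_apply hf (measurableSet_singleton i)] at hi

variable {p : Params} {H : Type*} [MeasurableSpace H] (c : Fading p H) (A : Arrivals p.N)

theorem Policy.indepFun_queue_slot (π : Policy p) (q0 : Fin p.N → ℝ) (t : ℕ) :
    IndepFun (π.queue c q0 t) (fun ω => ω t) (pathLaw c A) := by
  rw [funext (π.queue_eq_pastQueue c q0 t)]
  exact (indepFun_past_slot c A t).comp (π.measurable_pastQueue c q0 t) measurable_id

variable {f : unitInterval → Finset (Fin p.N)} (hf : ∀ T, MeasurableSet {u | f u = T})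

/-- The stationary policy that draws the active set from the coin alone. -/
def stationaryPolicy : Policy p where
  choose _ u := f u
  measurable T := measurable_snd (hf T)

include hf in
theorem lintegral_service_stationary (t : ℕ) (k : Fin p.N) :
    ∫⁻ ω, ENNReal.ofReal (c.service (f (ω t).2.2) (ω t).2.1 k) ∂pathLaw c A =
      ∑ T, volume {u | f u = T} * ENNReal.ofReal (p.ratePoint T k) := by
  refine (((stationaryPolicy hf).toCausal c 0).lintegral_served c A t k).trans ?_
  exact Finset.sum_congr rfl fun T _ => congrArg (· * _)
    ((measurePreserving_coin c A t).measure_preimage (hf T).nullMeasurableSet)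

theorem lintegral_sq_queue_stationary_drift : ∃ K : ℝ, ∀ q0 t k,
    ∫⁻ ω, ENNReal.ofReal ((stationaryPolicy hf).queue c q0 (t + 1) ω k ^ 2) ∂pathLaw c A +
        2 * ((∫⁻ ω, ENNReal.ofReal ((stationaryPolicy hf).queue c q0 t ω k) ∂pathLaw c A) *
          ∑ T, volume {u | f u = T} * ENNReal.ofReal (p.ratePoint T k)) ≤
      ∫⁻ ω, ENNReal.ofReal ((stationaryPolicy hf).queue c q0 t ω k ^ 2) ∂pathLaw c A +
        ENNReal.ofReal K +
        2 * ((∫⁻ ω, ENNReal.ofReal ((stationaryPolicy hf).queue c q0 t ω k) ∂pathLaw c A) *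
          ENNReal.ofReal (A.mean k)) := by
  obtain ⟨M, hM⟩ := exists_ae_arrival_le c A
  refine ⟨M ^ 2 + (p.d * p.R) ^ 2, fun q0 t k => ?_⟩
  have hservice : Measurable fun y : Slot p H => c.service (f y.2.2) y.2.1 k :=
    c.measurable_service_comp (fun T => measurable_snd.snd (hf T)) (by fun_prop) k
  have hind := (stationaryPolicy hf).indepFun_queue_slot c A q0 t
  rw [← lintegral_service_stationary c A hf t k, ← lintegral_arrival c A t k]
  exact lintegral_sq_max_sub_add_add_le
    ((measurable_pi_apply k).comp ((stationaryPolicy hf).measurable_queue c q0 t))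
    (by fun_prop) (hservice.comp (measurable_pi_apply t))
    (hind.comp (measurable_pi_apply k) ((measurable_pi_apply k).comp measurable_fst))
    (hind.comp (measurable_pi_apply k) hservice) (hM t k)
    (ae_of_all _ fun ω => ⟨c.service_nonneg _ _ k, c.service_le _ _ k⟩)

theorem stronglyStable_stationaryPolicy {ε : ℝ} (hε : 0 < ε)
    (hrate : ∀ k, ∑ T, volume {u | f u = T} * ENNReal.ofReal (p.ratePoint T k) =
      ENNReal.ofReal (A.mean k + ε)) (q0 : Fin p.N → ℝ) :
    StronglyStable (pathLaw c A) ((stationaryPolicy hf).queue c q0) := by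
  intro k
  obtain ⟨K, hK⟩ := lintegral_sq_queue_stationary_drift c A hf
  simp only [hrate, ENNReal.ofReal_add (A.mean_nonneg _) hε.le] at hK
  refine limsup_sum_div_lt_top_of_drift
    (V := fun t => ∫⁻ ω, ENNReal.ofReal ((stationaryPolicy hf).queue c q0 t ω k ^ 2) ∂pathLaw c A)
    ENNReal.ofReal_ne_top (ENNReal.ofReal_pos.2 hε).ne' ENNReal.ofReal_ne_top
    ENNReal.ofReal_ne_top (by simp [Policy.queue]) (fun t => ?_) fun t => hK q0 t k
  have hone : (1 : ℝ≥0∞) = ∫⁻ _, 1 ∂pathLaw c A := by rw [lintegral_one, measure_univ]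
  rw [hone, ← lintegral_add_left measurable_const]
  refine lintegral_mono fun ω => ?_
  rw [← ENNReal.ofReal_one, ← ENNReal.ofReal_add zero_le_one (sq_nonneg _)]
  refine ENNReal.ofReal_le_ofReal ?_
  nlinarith [sq_nonneg ((stationaryPolicy hf).queue c q0 t ω k - 1)]

end Stationary

/-! ### The stability region -/

section Region

variable {p : Params} {H : Type*} [MeasurableSpace H] (c : Fading p H)

theorem mem_stabilityRegion_of_add_mem_rateRegion {a : Fin p.N → ℝ} (ha : 0 ≤ a) {ε : ℝ}
    (hε : 0 < ε) (haε : (fun k => a k + ε) ∈ p.rateRegion) : a ∈ stabilityRegion c := by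
  rw [Params.rateRegion, convexHull_range_eq_image_stdSimplex] at haε
  obtain ⟨w, hw, hwa⟩ := haε
  obtain ⟨f, hf⟩ := exists_map_unitInterval_of_mem_stdSimplex hw
  refine ⟨ha, stationaryPolicy fun T => (hf T).1, fun A hA q0 _ =>
    stronglyStable_stationaryPolicy c A (fun T => (hf T).1) hε (fun k => ?_) q0⟩
  have hnonneg (T : Finset (Fin p.N)) : 0 ≤ w T * p.ratePoint T k :=
    mul_nonneg (hw.1 T) (p.ratePoint_nonneg T k)
  have hk := congrFun hwa k
  simp only [Finset.sum_apply, Pi.smul_apply, smul_eq_mul] at hk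
  rw [hA, ← hk, ENNReal.ofReal_sum_of_nonneg fun T _ => hnonneg T]
  exact Finset.sum_congr rfl fun T _ => by rw [(hf T).2, ENNReal.ofReal_mul (hw.1 T)]

theorem mem_stabilityRegion_of_mem_nhdsWithin {a : Fin p.N → ℝ} (ha : 0 ≤ a)
    (hmem : p.rateRegion ∈ 𝓝[Set.Ici 0] a) : a ∈ stabilityRegion c := by
  have hcont : Continuous fun (ε : ℝ) k => a k + ε := by fun_prop
  have hlim : Tendsto (fun (ε : ℝ) k => a k + ε) (𝓝[>] 0) (𝓝[Set.Ici 0] a) :=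
    tendsto_nhdsWithin_iff.2 ⟨(hcont.tendsto' 0 a (by simp)).mono_left nhdsWithin_le_nhds,
      eventually_nhdsWithin_of_forall fun ε hε k => add_nonneg (ha k) (le_of_lt hε)⟩
  obtain ⟨ε, haε, hε⟩ := ((hlim.eventually hmem).and self_mem_nhdsWithin).exists
  exact mem_stabilityRegion_of_add_mem_rateRegion c ha hε haε

/-- Deterministic arrivals. They show that the region of vectors stabilized for every arrival law
contains only vectors that are means of some arrival law. -/
noncomputable def diracArrivals {N : ℕ} {a : Fin N → ℝ} (ha : 0 ≤ a) : Arrivals N where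
  law k := Measure.dirac (a k)
  isProb _ := inferInstance
  bounded := by
    refine ⟨∑ k, a k + 1, fun k => (ae_dirac_iff (measurableSet_Ici.inter measurableSet_Iio)).2
      ⟨ha k, Set.mem_Iio.2 (lt_add_of_le_of_pos ?_ one_pos)⟩⟩
    exact Finset.single_le_sum (fun i _ => ha i) (Finset.mem_univ k)

theorem mean_diracArrivals {N : ℕ} {a : Fin N → ℝ} (ha : 0 ≤ a) : (diracArrivals ha).mean = a :=
  funext fun _ => integral_dirac _ _

theorem stabilityRegion_subset_rateRegion : stabilityRegion c ⊆ p.rateRegion := by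
  rintro a ⟨ha, π, hπ⟩
  have hstable := hπ _ (mean_diracArrivals ha) 0 le_rfl
  rw [← π.queue_toCausal c 0] at hstable
  simpa only [mean_diracArrivals] using (π.toCausal c 0).mean_mem_rateRegion c _ 0 hstable

theorem rateRegion_subset_closure_stabilityRegion :
    p.rateRegion ⊆ closure (stabilityRegion c) := by
  intro a ha
  obtain ⟨η, hη, hηmem⟩ := p.exists_const_mem_rateRegion
  have hshrink (s : ℝ) (hs : s ∈ Set.Ioo (0 : ℝ) 1) : (1 - s) • a ∈ stabilityRegion c := by
    have hs₁ : 0 ≤ 1 - s := by linarith [hs.2]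
    exact mem_stabilityRegion_of_add_mem_rateRegion c
      (smul_nonneg hs₁ (p.rateRegion_subset_Ici ha)) (mul_pos hs.1 hη)
      (p.convex_rateRegion ha hηmem hs₁ hs.1.le (by ring))
  have hcont : Continuous fun s : ℝ => (1 - s) • a := by fun_prop
  refine mem_closure_of_tendsto
    ((hcont.tendsto' 0 a (by simp)).mono_left (nhdsWithin_le_nhds (s := Set.Ioi 0))) ?_
  filter_upwards [Ioo_mem_nhdsGT one_pos] using hshrink

theorem closure_stabilityRegion : closure (stabilityRegion c) = p.rateRegion :=
  (closure_minimal (stabilityRegion_subset_rateRegion c) p.isClosed_rateRegion).antisymm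
    (rateRegion_subset_closure_stabilityRegion c)

end Region

end SymIA

theorem mainTheorem1_general (p : SymIA.Params) {H : Type*} [MeasurableSpace H]
    (c : SymIA.Fading p H) {LI : ℕ} (hLI : ∀ L ≤ p.N, p.rT L ≤ p.rT LI) :
    closure (SymIA.stabilityRegion c) = p.rateHull LI ∧
    (∀ a : Fin p.N → ℝ, 0 ≤ a → p.rateHull LI ∈ 𝓝[Set.Ici 0] a → a ∈ SymIA.stabilityRegion c) ∧
    (∀ (A : SymIA.Arrivals p.N) (π : SymIA.CausalPolicy p H) (q0 : Fin p.N → ℝ),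
      SymIA.StronglyStable (SymIA.pathLaw c A) (π.queue c q0) → A.mean ∈ p.rateHull LI) := by
  rw [p.rateHull_eq_rateRegion hLI]
  exact ⟨SymIA.closure_stabilityRegion c, fun _ => SymIA.mem_stabilityRegion_of_mem_nhdsWithin c,
    fun A π => π.mean_mem_rateRegion c A⟩

theorem mainTheorem1 (p : SymIA.Params) {H : Type*} [MeasurableSpace H] (c : SymIA.Fading p H)
    (LI : ℕ) (hLI : ∀ L : ℕ, p.rT L ≤ p.rT LI) :
    closure (SymIA.stabilityRegion c) = p.rateHull LI ∧
    (∀ a : Fin p.N → ℝ, 0 ≤ a → p.rateHull LI ∈ 𝓝[Set.Ici 0] a → a ∈ SymIA.stabilityRegion c) ∧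
    (∀ (A : SymIA.Arrivals p.N) (π : SymIA.CausalPolicy p H) (q0 : Fin p.N → ℝ), 0 ≤ q0 →
      SymIA.StronglyStable (SymIA.pathLaw c A) (π.queue c q0) → A.mean ∈ p.rateHull LI) := by
  obtain ⟨hclosure, hinterior, hcausal⟩ := mainTheorem1_general p c fun L _ => hLI L
  exact ⟨hclosure, hinterior, fun A π q0 _ => hcausal A π q0⟩
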